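/- Let $\pi$ be a convex polygon with $n\ge 7$ vertices (in strictly convex position). A triangulation of $\pi$ is an inclusion-maximal set of pairwise non-crossing edges (pairs of distinct vertices of $\pi$); its interior edges are those whose convex hull is not disjoint from the interior of $\pi$, i.e. that are not sides of $\pi$. The flip-graph of $\pi$ has the triangulations of $\pi$ as vertices, two of them being adjacent when they differ by a single edge; the eccentricity of a triangulation is its largest distance to a triangulation in this graph. Then there exist an integer $k$ with $$\frac n8-\frac52<k\le\frac n2-2$$ and a triangulation $T$ of $\pi$ such that every vertex of $\pi$ is incident to at most $n-4-k$ interior edges of $T$, and the eccentricity of $T$ in the flip-graph of $\pi$ is exactly $n-3+k$. Consequently, it is not true that for every integer $k$ with $0\le k\le\lfloor n/2\rfloor-2$ and every triangulation $T$ of $\pi$, the triangulation $T$ has eccentricity $n-3+k$ if and only if some vertex of $\pi$ is incident to exactly $n-3-k$ interior edges of $T$. -/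

import Mathlib

/-- The Euclidean plane. -/
abbrev Plane : Type := EuclideanSpace ℝ (Fin 2)

namespace FlipGraph

/-- `V` is the vertex set of a convex polygon: at least three points in (strictly) convex position.
The polygon itself is `convexHull ℝ V`. -/
def IsConvexPolygon (V : Finset Plane) : Prop :=
  3 ≤ V.card ∧ ConvexIndependent ℝ (fun x : V => (x : Plane))

/-- An edge on the polygon: an unordered pair of two distinct vertices. -/
def IsEdgeOn (V : Finset Plane) (e : Sym2 Plane) : Prop :=
  ¬ e.IsDiag ∧ ∀ x ∈ e, x ∈ V

/-- The convex hull of an edge. -/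
def hull (e : Sym2 Plane) : Set Plane := convexHull ℝ {x | x ∈ e}

/-- The (relative) interior of the convex hull of an edge: the open segment between its ends. -/
def relInterior (e : Sym2 Plane) : Set Plane :=
  {x | ∃ a b : Plane, e = s(a, b) ∧ x ∈ openSegment ℝ a b}

/-- An edge on the polygon is an edge of the polygon when its convex hull is disjoint from the
interior of the polygon. -/
def IsEdgeOf (V : Finset Plane) (e : Sym2 Plane) : Prop :=
  IsEdgeOn V e ∧ Disjoint (hull e) (interior (convexHull ℝ (V : Set Plane)))

/-- Two edges cross when their convex hulls have non-disjoint interiors. -/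
def Crossing (e f : Sym2 Plane) : Prop :=
  ¬ Disjoint (relInterior e) (relInterior f)

/-- A triangulation: an inclusion-maximal set of pairwise non-crossing edges on the polygon. -/
def IsTriangulation (V : Finset Plane) (T : Set (Sym2 Plane)) : Prop :=
  Maximal (fun S : Set (Sym2 Plane) =>
    (∀ e ∈ S, IsEdgeOn V e) ∧ S.Pairwise (fun e f => ¬ Crossing e f)) T

/-- The type of triangulations of the polygon with vertex set `V`. -/
abbrev Triangulation (V : Finset Plane) : Type :=
  {T : Set (Sym2 Plane) // IsTriangulation V T}

/-- The interior edges of a triangulation: those that are not edges of the polygon. -/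
def interiorEdges {V : Finset Plane} (T : Triangulation V) : Set (Sym2 Plane) :=
  {e | e ∈ T.1 ∧ ¬ IsEdgeOf V e}

/-- The number of interior edges of `T` incident to `v`. -/
noncomputable def interiorDegree {V : Finset Plane} (T : Triangulation V) (v : Plane) : ℕ :=
  {e | e ∈ interiorEdges T ∧ v ∈ e}.ncard

/-- The flip-graph: two triangulations are adjacent when they differ by a single edge. -/
def flipGraph (V : Finset Plane) : SimpleGraph (Triangulation V) where
  Adj T U := ∃ e f : Sym2 Plane, T.1 \ U.1 = {e} ∧ U.1 \ T.1 = {f}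
  symm := ⟨fun _ _ ⟨e, f, h, h'⟩ => ⟨f, e, h', h⟩⟩
  loopless := ⟨fun T ⟨e, _, h, _⟩ => by simp at h⟩

/-- The triangulation `T` has eccentricity equal to the integer `m` in the flip-graph. -/
def HasEccentricity {V : Finset Plane} (T : Triangulation V) (m : ℤ) : Prop :=
  ∃ d : ℕ, (flipGraph V).eccent T = d ∧ (d : ℤ) = m

end FlipGraph

/-! Label the vertices 0, …, n - 1 counterclockwise and let n = 2D + 3 or n = 2D + 4. The witness is
`doubleFan`: the adjacent vertices 0 and n - 1 have D interior edges each, and no vertex has more.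

Upper bound: going through the full fan at a vertex v, the distance of two triangulations is at most
2(n - 3) minus their two interior degrees at v. The side joining 0 and n - 1 lies in a triangle, so
every triangulation has an interior edge at one of these two vertices. Choosing that vertex as v
saves one flip more than D, and the eccentricity is at most 2(n - 3) - D - 1. Writing it as n - 3 +
k gives D ≤ n - 4 - k, so no vertex has interior degree n - 3 - k.

Lower bound, needed to keep k large and nonnegative: take a triangulation containing `zigzag`, a
path of n - 4 edges. A flip exchanging a double fan edge for a zigzag edge needs a quadrilateral
with a side that belongs to neither set and touches the new edge (`exists_side_of_flip`). Such a bad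
side costs a wasted flip and touches at most four zigzag edges. The bookkeeping in `Reachable`
yields at least (n - 4)/5 wasted flips, hence a distance of at least 6(n - 4)/5, that is 5k ≥ n - 9.

Geometry enters only through two facts: edges cross when their indices interleave
(`IsEnumeration.crossing_iff`), and sides join cyclically consecutive indices
(`IsEnumeration.isEdgeOf_iff`). -/

namespace FlipGraph

/-! ### Orientation of triples of points -/

/-- Twice the signed area of the triangle `a b c`. -/
def orient (a b c : Plane) : ℝ :=
  (b 0 - a 0) * (c 1 - a 1) - (b 1 - a 1) * (c 0 - a 0)

theorem Plane.ext {a b : Plane} (h0 : a 0 = b 0) (h1 : a 1 = b 1) : a = b := by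
  ext i
  fin_cases i
  · exact h0
  · exact h1

theorem orient_rotate (a b c : Plane) : orient a b c = orient b c a := by
  simp only [orient]; ring

theorem orient_swap (a b c : Plane) : orient a b c = - orient b a c := by
  simp only [orient]; ring

theorem orient_left_self (a b : Plane) : orient a b a = 0 := by
  simp only [orient]; ring

theorem orient_right_self (a b : Plane) : orient a b b = 0 := by
  simp only [orient]; ring

theorem orient_combo (a b c d : Plane) {s t : ℝ} (h : s + t = 1) :
    orient a b (s • c + t • d) = s * orient a b c + t * orient a b d := by
  obtain rfl : t = 1 - s := by linarith
  simp only [orient, PiLp.add_apply, PiLp.smul_apply, smul_eq_mul]; ring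

theorem continuous_orient (a b : Plane) : Continuous (fun x => orient a b x) := by
  unfold orient; fun_prop

theorem mem_convexHull_triangle {a b c x : Plane} (h : 0 < orient a b c)
    (h1 : 0 ≤ orient a b x) (h2 : 0 ≤ orient b c x) (h3 : 0 ≤ orient c a x) :
    x ∈ convexHull ℝ {a, b, c} := by
  have key := (convex_convexHull ℝ ({a, b, c} : Set Plane)).sum_mem (t := Finset.univ)
    (w := ![orient b c x / orient a b c, orient c a x / orient a b c,
      orient a b x / orient a b c]) (z := ![a, b, c]) ?_ ?_ ?_
  · convert key using 1
    have hne := h.ne'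
    rw [Fin.sum_univ_three]
    apply Plane.ext <;>
    · simp only [Matrix.cons_val, PiLp.add_apply, PiLp.smul_apply, smul_eq_mul]
      field_simp
      simp only [orient]; ring
  · intro i _
    fin_cases i <;> simp <;> positivity
  · rw [Fin.sum_univ_three]
    simp only [Matrix.cons_val]
    rw [← add_div, ← add_div, div_eq_one_iff_eq h.ne']
    simp only [orient]; ring
  · intro i _
    apply subset_convexHull
    fin_cases i <;> simp

theorem relInterior_mk (a b : Plane) : relInterior s(a, b) = openSegment ℝ a b := by
  ext x
  constructor
  · rintro ⟨c, d, h, hx⟩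
    rcases Sym2.eq_iff.mp h with ⟨rfl, rfl⟩ | ⟨rfl, rfl⟩
    · exact hx
    · rwa [openSegment_symm]
  · exact fun hx => ⟨a, b, rfl, hx⟩

theorem hull_mk (a b : Plane) : hull s(a, b) = segment ℝ a b := by
  rw [hull, ← convexHull_pair]
  congr 1
  ext x
  simp

theorem crossing_comm {e f : Sym2 Plane} : Crossing e f ↔ Crossing f e := by
  rw [Crossing, Crossing, disjoint_comm]

/-! ### Counterclockwise enumeration of a convex polygon -/

theorem not_mem_convexHull_of_subset {V : Finset Plane} (hV : IsConvexPolygon V) {x : Plane}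
    {s : Set Plane} (hx : x ∈ V) (hs : s ⊆ V) (hxs : x ∉ s) : x ∉ convexHull ℝ s := by
  intro h
  refine convexIndependent_set_iff_notMem_convexHull_sdiff.mp hV.2 x hx ?_
  have hsub : s ⊆ (V : Set Plane) \ {x} := fun y hy => ⟨hs hy, fun hyx => hxs (hyx ▸ hy)⟩
  exact convexHull_mono hsub h

/-- A counterclockwise enumeration of the vertices of a convex polygon. -/
structure IsEnumeration (V : Finset Plane) (n : ℕ) (p : ℕ → Plane) : Prop where
  mem : ∀ i < n, p i ∈ V
  surj : ∀ v ∈ V, ∃ i < n, p i = v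
  pos : ∀ i j k, i < j → j < k → k < n → 0 < orient (p i) (p j) (p k)

theorem Plane.functional_eq (f : StrongDual ℝ Plane) :
    ∃ A B : ℝ, ∀ u : Plane, f u = A * u 0 + B * u 1 := by
  refine ⟨f (EuclideanSpace.single 0 1), f (EuclideanSpace.single 1 1), fun u => ?_⟩
  have hu : u = u 0 • EuclideanSpace.single 0 1 + u 1 • EuclideanSpace.single 1 1 := by
    apply Plane.ext <;> simp
  conv_lhs => rw [hu]
  rw [map_add, map_smul, map_smul, smul_eq_mul, smul_eq_mul]; ring

/-- A functional separating `o` from the other vertices puts them in an open half-plane seen from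
`o`, where comparing slopes decides orientation. Equal slopes would place one vertex on the segment
from `o` to another. -/
theorem exists_slope {V : Finset Plane} (hV : IsConvexPolygon V) {o : Plane} (ho : o ∈ V) :
    ∃ t : Plane → ℝ, Set.InjOn t (V.erase o) ∧
      ∀ u ∈ V.erase o, ∀ w ∈ V.erase o, t u < t w → 0 < orient o u w := by
  obtain ⟨f, m, hm, hf⟩ := geometric_hahn_banach_point_closed
    (convex_convexHull ℝ ((V.erase o : Finset Plane) : Set Plane))
    ((V.erase o).finite_toSet.isClosed_convexHull ℝ)
    (not_mem_convexHull_of_subset hV ho (by simp) (by simp))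
  obtain ⟨A, B, hAB⟩ := Plane.functional_eq f
  have hs : ∀ u ∈ V.erase o, 0 < A * (u 0 - o 0) + B * (u 1 - o 1) := by
    intro u hu
    have := hf u (subset_convexHull ℝ _ hu)
    rw [hAB] at hm this
    linarith
  set s : Plane → ℝ := fun u => A * (u 0 - o 0) + B * (u 1 - o 1) with s_def
  set g : Plane → ℝ := fun u => A * (u 1 - o 1) - B * (u 0 - o 0) with g_def
  have hgs : ∀ u w, g w * s u - g u * s w = (A ^ 2 + B ^ 2) * orient o u w := by
    intro u w; simp only [s_def, g_def, orient]; ring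
  have hcol : ∀ u ∈ V.erase o, ∀ w ∈ V.erase o, g u * s w = g w * s u → s u ≤ s w → u = w := by
    intro u hu w hw hg hle
    by_contra hne
    have hsw : 0 < s w := hs w hw
    have hsu : 0 < s u := hs u hu
    have h0 : (A ^ 2 + B ^ 2) * orient o u w = 0 := by rw [← hgs]; linarith
    have hAB0 : A ^ 2 + B ^ 2 ≠ 0 := by
      intro h
      have hA : A = 0 := by nlinarith [sq_nonneg A, sq_nonneg B]
      have hB : B = 0 := by nlinarith [sq_nonneg A, sq_nonneg B]
      simp [s_def, hA, hB] at hsw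
    have h1 : orient o u w = 0 := by simpa [hAB0] using h0
    refine not_mem_convexHull_of_subset hV (Finset.mem_of_mem_erase hu)
      (s := {o, w}) ?_ ?_ ?_
    · rintro x (rfl | rfl)
      · exact ho
      · exact Finset.mem_of_mem_erase hw
    · rintro (h | h)
      · exact Finset.ne_of_mem_erase hu h
      · exact hne h
    · rw [convexHull_pair]
      refine ⟨1 - s u / s w, s u / s w, ?_, by positivity, by ring, ?_⟩
      · rw [sub_nonneg, div_le_one hsw]; exact hle
      · have hs0 : s w ≠ 0 := hsw.ne'
        simp only [orient] at h1
        apply Plane.ext <;>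
        · simp only [PiLp.add_apply, PiLp.smul_apply, smul_eq_mul]
          field_simp
          simp only [s_def]
          first
          | linear_combination (-B) * h1
          | linear_combination A * h1
  refine ⟨fun u => g u / s u, ?_, ?_⟩
  · intro u hu w hw huw
    have hsu : 0 < s u := hs u hu
    have hsw : 0 < s w := hs w hw
    rw [div_eq_div_iff hsu.ne' hsw.ne'] at huw
    rcases le_total (s u) (s w) with h | h
    · exact hcol u hu w hw huw h
    · exact (hcol w hw u hu huw.symm h).symm
  · intro u hu w hw huw
    rw [div_lt_div_iff₀ (hs u hu) (hs w hw)] at huw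
    have h1 := hgs u w
    have h2 : 0 < (A ^ 2 + B ^ 2) * orient o u w := by rw [← h1]; linarith
    exact pos_of_mul_pos_right h2 (by positivity)

theorem exists_isEnumeration {V : Finset Plane} (hV : IsConvexPolygon V) {n : ℕ}
    (hn : V.card = n) : ∃ p, IsEnumeration V n p := by
  classical
  have h3 := hV.1
  obtain ⟨o, ho⟩ : V.Nonempty := Finset.card_pos.mp (by omega)
  obtain ⟨t, hinj, ht⟩ := exists_slope hV ho
  have hcard : ((V.erase o).image t).card = n - 1 := by
    rw [Finset.card_image_of_injOn hinj, Finset.card_erase_of_mem ho, hn]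
  set e := ((V.erase o).image t).orderEmbOfFin hcard
  have hq : ∀ i : Fin (n - 1), ∃ w ∈ V.erase o, t w = e i := fun i =>
    Finset.mem_image.mp (Finset.orderEmbOfFin_mem _ hcard i)
  choose q hqV hqt using hq
  set p : ℕ → Plane := fun i => if h : 0 < i ∧ i - 1 < n - 1 then q ⟨i - 1, h.2⟩ else o with hp
  have hp0 : p 0 = o := by simp [hp]
  have hpq : ∀ i (h : 0 < i ∧ i - 1 < n - 1), p i = q ⟨i - 1, h.2⟩ := fun i h => dif_pos h
  have hmemW : ∀ i, 0 < i → i < n → p i ∈ V.erase o := by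
    intro i h0 hi
    rw [hpq i ⟨h0, by omega⟩]
    exact hqV _
  have hpV : ∀ i < n, p i ∈ V := by
    intro i hi
    rcases Nat.eq_zero_or_pos i with rfl | h
    · rwa [hp0]
    · exact Finset.mem_of_mem_erase (hmemW i h hi)
  have ht_lt : ∀ i j, 0 < i → i < j → j < n → t (p i) < t (p j) := by
    intro i j h0 hij hj
    rw [hpq i ⟨h0, by omega⟩, hpq j ⟨by omega, by omega⟩, hqt, hqt]
    apply e.strictMono
    rw [Fin.lt_def]
    dsimp only
    omega
  have hpos0 : ∀ i j, 0 < i → i < j → j < n → 0 < orient o (p i) (p j) := fun i j h0 hij hj =>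
    ht _ (hmemW i h0 (by omega)) _ (hmemW j (by omega) hj) (ht_lt i j h0 hij hj)
  refine ⟨p, hpV, ?_, ?_⟩
  · intro v hv
    by_cases hvo : v = o
    · exact ⟨0, by omega, by rw [hp0, hvo]⟩
    · have hvW : v ∈ V.erase o := Finset.mem_erase.mpr ⟨hvo, hv⟩
      have : t v ∈ Set.range e := by
        rw [Finset.range_orderEmbOfFin]
        exact Finset.mem_coe.mpr (Finset.mem_image_of_mem _ hvW)
      obtain ⟨i, hi⟩ := this
      refine ⟨i + 1, by omega, ?_⟩
      rw [hpq (i + 1) ⟨by omega, by simp⟩]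
      apply hinj (hqV _) hvW
      rw [hqt, ← hi]
      rfl
  · intro i j k hij hjk hk
    rcases Nat.eq_zero_or_pos i with rfl | hi
    · rw [hp0]; exact hpos0 j k (by omega) hjk hk
    -- A wrong orientation would put `p j` in the triangle `o`, `p i`, `p k`.
    · by_contra hneg
      push Not at hneg
      have h1 := hpos0 i j hi hij (by omega)
      have h2 := hpos0 j k (by omega) hjk hk
      have h3 := hpos0 i k hi (by omega) hk
      refine not_mem_convexHull_of_subset hV (hpV j (by omega)) (s := {o, p i, p k}) ?_ ?_
        (mem_convexHull_triangle h3 h1.le ?_ ?_)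
      · rintro x (rfl | rfl | rfl)
        · exact ho
        · exact hpV i (by omega)
        · exact hpV k hk
      · have hij' := ht_lt i j hi hij (by omega)
        have hjk' := ht_lt j k (by omega) hjk hk
        rintro (h | h | h)
        · exact Finset.ne_of_mem_erase (hmemW j (by omega) (by omega)) h
        · exact hij'.ne (by rw [h])
        · exact hjk'.ne (by rw [h])
      · have : orient (p i) (p k) (p j) = - orient (p i) (p j) (p k) := by
          simp only [orient]; ring
        linarith
      · rw [orient_rotate]
        exact h2.le

/-! ### Crossings and sides in terms of indices -/

theorem orient_nonneg_of_mem_convexHull {a b : Plane} {s : Set Plane}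
    (h : ∀ y ∈ s, 0 ≤ orient a b y) {x : Plane} (hx : x ∈ convexHull ℝ s) : 0 ≤ orient a b x := by
  have hconv : Convex ℝ {y | 0 ≤ orient a b y} := by
    intro y hy z hz α β hα hβ hαβ
    replace hy : 0 ≤ orient a b y := hy
    replace hz : 0 ≤ orient a b z := hz
    change 0 ≤ orient a b (α • y + β • z)
    rw [orient_combo _ _ _ _ hαβ]
    positivity
  exact convexHull_min h hconv hx

/-- Moving `x` slightly away from `c` stays in `s`, but would make the affine function `orient a b`
negative if it vanished at `x`. -/
theorem orient_pos_of_mem_interior {a b c : Plane} {s : Set Plane}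
    (h : ∀ y ∈ s, 0 ≤ orient a b y) (hc : 0 < orient a b c) {x : Plane}
    (hx : x ∈ interior s) : 0 < orient a b x := by
  have hcont : Continuous (fun ε : ℝ => (1 + ε) • x + (-ε) • c) := by fun_prop
  have hev : ∀ᶠ ε in nhds (0 : ℝ), (1 + ε) • x + (-ε) • c ∈ interior s := by
    apply hcont.continuousAt.eventually
    apply isOpen_interior.mem_nhds
    simpa using hx
  obtain ⟨ε, hε, hε0⟩ := ((hev.filter_mono nhdsWithin_le_nhds).and
    (self_mem_nhdsWithin : Set.Ioi (0 : ℝ) ∈ nhdsWithin 0 (Set.Ioi 0))).exists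
  have h1 := h _ (interior_subset hε)
  rw [orient_combo _ _ _ _ (by ring)] at h1
  replace hε0 : 0 < ε := hε0
  have : 0 < (1 + ε) * orient a b x := by nlinarith
  exact pos_of_mul_pos_right this (by linarith)

/-- The weights are ratios of triangle areas; cutting the quadrilateral along either diagonal gives
the same total area, hence a common denominator. -/
theorem exists_mem_openSegment_inter {a b c d : Plane} (h1 : 0 < orient a b c)
    (h2 : 0 < orient a b d) (h3 : 0 < orient a c d) (h4 : 0 < orient b c d) :
    ∃ x, x ∈ openSegment ℝ a c ∧ x ∈ openSegment ℝ b d := by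
  have hS : 0 < orient b c d + orient a b d := by linarith
  have hS' : orient a c d + orient a b c = orient b c d + orient a b d := by
    simp only [orient]; ring
  refine ⟨(orient b c d / (orient b c d + orient a b d)) • a +
    (orient a b d / (orient b c d + orient a b d)) • c,
    ⟨_, _, by positivity, by positivity, by field_simp, rfl⟩,
    ⟨orient a c d / (orient b c d + orient a b d), orient a b c / (orient b c d + orient a b d),
      by positivity, by positivity, ?_, ?_⟩⟩
  · rw [← add_div, hS', div_self hS.ne']
  · have hne := hS.ne'
    apply Plane.ext <;>
    · simp only [PiLp.add_apply, PiLp.smul_apply, smul_eq_mul]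
      field_simp
      simp only [orient]; ring

theorem disjoint_openSegment {a b c d : Plane} (hc : 0 ≤ orient a b c) (hd : 0 ≤ orient a b d)
    (hcd : 0 < orient a b c + orient a b d) :
    Disjoint (openSegment ℝ a b) (openSegment ℝ c d) := by
  rw [Set.disjoint_left]
  rintro x ⟨α, β, -, -, hαβ, rfl⟩ ⟨γ, δ, hγ, hδ, hγδ, hx⟩
  have h1 : orient a b (α • a + β • b) = 0 := by
    rw [orient_combo _ _ _ _ hαβ, orient_left_self, orient_right_self]; ring
  rw [← hx, orient_combo _ _ _ _ hγδ] at h1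
  rcases hc.lt_or_eq with h | h
  · have : 0 < γ * orient a b c := by positivity
    have : 0 ≤ δ * orient a b d := by positivity
    linarith
  · have : 0 < δ * orient a b d := by
      have : 0 < orient a b d := by linarith
      positivity
    have : 0 ≤ γ * orient a b c := by positivity
    linarith

/-- The edges `e` and `f`, given by increasing pairs of indices, interleave. -/
def Interleave (e f : ℕ × ℕ) : Prop :=
  (e.1 < f.1 ∧ f.1 < e.2 ∧ e.2 < f.2) ∨ (f.1 < e.1 ∧ e.1 < f.2 ∧ f.2 < e.2)

theorem Interleave.symm {e f : ℕ × ℕ} (h : Interleave e f) : Interleave f e := Or.symm h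

/-- An enumeration of the vertices of a convex polygon for which edges cross when their pairs of
indices interleave. -/
structure IsVertexLabelling (V : Finset Plane) (n : ℕ) (p : ℕ → Plane) : Prop where
  mem : ∀ i < n, p i ∈ V
  surj : ∀ v ∈ V, ∃ i < n, p i = v
  inj : ∀ i < n, ∀ j < n, p i = p j → i = j
  crossing : ∀ e f : ℕ × ℕ, e.1 < e.2 → e.2 < n → f.1 < f.2 → f.2 < n → e ≠ f →
    (Crossing s(p e.1, p e.2) s(p f.1, p f.2) ↔ Interleave e f)

namespace IsVertexLabelling

variable {V : Finset Plane} {n : ℕ} {p : ℕ → Plane}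

theorem isEdgeOn (hp : IsVertexLabelling V n p) {i j : ℕ} (hij : i < j) (hj : j < n) :
    IsEdgeOn V s(p i, p j) := by
  refine ⟨?_, ?_⟩
  · rw [Sym2.mk_isDiag_iff]
    intro h
    exact hij.ne (hp.inj _ (by omega) _ hj h)
  · intro x hx
    rcases Sym2.mem_iff.mp hx with rfl | rfl
    · exact hp.mem i (by omega)
    · exact hp.mem j hj

theorem exists_of_isEdgeOn (hp : IsVertexLabelling V n p) {e : Sym2 Plane} (he : IsEdgeOn V e) :
    ∃ i j, i < j ∧ j < n ∧ e = s(p i, p j) := by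
  induction e with
  | _ a b =>
    obtain ⟨i, hi, rfl⟩ := hp.surj a (he.2 a (Sym2.mem_mk_left a b))
    obtain ⟨j, hj, rfl⟩ := hp.surj b (he.2 b (Sym2.mem_mk_right (p i) b))
    rcases lt_trichotomy i j with h | rfl | h
    · exact ⟨i, j, h, hj, rfl⟩
    · exact (he.1 (Sym2.mk_isDiag_iff.mpr rfl)).elim
    · exact ⟨j, i, h, hi, Sym2.eq_swap⟩

/-- This lets the vertex `n - 1` play the part of `0`. Reversal destroys the counterclockwise order
but keeps the crossings, which is why the combinatorial part uses labellings instead of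
enumerations. -/
theorem reverse (hp : IsVertexLabelling V n p) :
    IsVertexLabelling V n fun i => p (n - 1 - i) := by
  refine ⟨fun i hi => hp.mem _ (by omega), fun v hv => ?_, fun i hi j hj h => ?_, ?_⟩
  · obtain ⟨i, hi, rfl⟩ := hp.surj v hv
    exact ⟨n - 1 - i, by omega, by congr 1; omega⟩
  · have := hp.inj _ (by omega) _ (by omega) h
    omega
  · rintro ⟨i, j⟩ ⟨k, l⟩ he he' hf hf' hef
    have := hp.crossing (n - 1 - j, n - 1 - i) (n - 1 - l, n - 1 - k) (by simp only at *; omega)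
      (by simp only at *; omega) (by simp only at *; omega) (by simp only at *; omega)
      (by simp only [ne_eq, Prod.mk.injEq] at *; omega)
    rw [Sym2.eq_swap, Sym2.eq_swap (a := p (n - 1 - k)), this]
    simp only [Interleave] at *
    omega

end IsVertexLabelling

namespace IsEnumeration

variable {V : Finset Plane} {n : ℕ} {p : ℕ → Plane}

theorem pos_out (hp : IsEnumeration V n p) {i j k : ℕ} (hij : i < j) (hj : j < n) (hk : k < n)
    (h : k < i ∨ j < k) : 0 < orient (p i) (p j) (p k) := by
  rcases h with h | h
  · rw [← orient_rotate]; exact hp.pos k i j h hij hj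
  · exact hp.pos i j k hij h hk

theorem pos_in (hp : IsEnumeration V n p) {i j k : ℕ} (hj : j < n) (hik : i < k)
    (hkj : k < j) : 0 < orient (p j) (p i) (p k) := by
  rw [orient_rotate]; exact hp.pos i k j hik hkj hj

theorem nonneg_out (hp : IsEnumeration V n p) {i j k : ℕ} (hij : i < j) (hj : j < n) (hk : k < n)
    (h : k ≤ i ∨ j ≤ k) : 0 ≤ orient (p i) (p j) (p k) := by
  rcases eq_or_ne k i with rfl | hki
  · rw [orient_left_self]
  rcases eq_or_ne k j with rfl | hkj
  · rw [orient_right_self]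
  exact (hp.pos_out hij hj hk (by omega)).le

theorem nonneg_in (hp : IsEnumeration V n p) {i j k : ℕ} (hj : j < n) (hik : i ≤ k)
    (hkj : k ≤ j) : 0 ≤ orient (p j) (p i) (p k) := by
  rcases eq_or_ne k i with rfl | hki
  · rw [orient_right_self]
  rcases eq_or_ne k j with rfl | hkj
  · rw [orient_left_self]
  exact (hp.pos_in hj (by omega) (by omega)).le

theorem injOn (hp : IsEnumeration V n p) (hn : 3 ≤ n) {i j : ℕ} (hi : i < n) (hj : j < n)
    (h : p i = p j) : i = j := by
  have key : ∀ i j, i < j → j < n → p i ≠ p j := by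
    intro i j hij hj h
    obtain ⟨k, hk, hki⟩ : ∃ k < n, k < i ∨ j < k ∨ (i < k ∧ k < j) := by
      by_cases h1 : 0 < i
      · exact ⟨0, by omega, by omega⟩
      by_cases h2 : j < n - 1
      · exact ⟨n - 1, by omega, by omega⟩
      · exact ⟨i + 1, by omega, by omega⟩
    have h0 : ∀ x, orient (p i) (p j) x = 0 := by
      intro x; rw [h]; simp only [orient]; ring
    have h0' : ∀ x, orient (p j) (p i) x = 0 := by
      intro x; rw [h]; simp only [orient]; ring
    rcases hki with hki | hki | hki
    · exact (hp.pos_out hij hj hk (Or.inl hki)).ne' (h0 _)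
    · exact (hp.pos_out hij hj hk (Or.inr hki)).ne' (h0 _)
    · exact (hp.pos_in hj hki.1 hki.2).ne' (h0' _)
  rcases lt_trichotomy i j with hij | hij | hij
  · exact (key i j hij hj h).elim
  · exact hij
  · exact (key j i hij hi h.symm).elim

theorem crossing_of_lt (hp : IsEnumeration V n p) {i k j l : ℕ} (hik : i < k) (hkj : k < j)
    (hjl : j < l) (hl : l < n) : Crossing s(p i, p j) s(p k, p l) := by
  obtain ⟨x, hx1, hx2⟩ := exists_mem_openSegment_inter (hp.pos i k j hik hkj (by omega))
    (hp.pos i k l hik (by omega) hl) (hp.pos i j l (by omega) hjl hl) (hp.pos k j l hkj hjl hl)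
  rw [Crossing, relInterior_mk, relInterior_mk]
  exact Set.not_disjoint_iff.mpr ⟨x, hx1, hx2⟩

theorem crossing_iff (hp : IsEnumeration V n p) {e f : ℕ × ℕ} (he : e.1 < e.2) (he' : e.2 < n)
    (hf : f.1 < f.2) (hf' : f.2 < n) (hef : e ≠ f) :
    Crossing s(p e.1, p e.2) s(p f.1, p f.2) ↔ Interleave e f := by
  obtain ⟨i, j⟩ := e
  obtain ⟨k, l⟩ := f
  simp only [ne_eq, Prod.mk.injEq] at he he' hf hf' hef ⊢
  constructor
  · intro h
    by_contra hI
    simp only [Interleave] at hI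
    apply h
    rw [relInterior_mk, relInterior_mk]
    rcases (by omega : (i ≤ k ∧ l ≤ j) ∨ ((k ≤ i ∨ j ≤ k) ∧ (l ≤ i ∨ j ≤ l))) with ⟨h1, h2⟩ | ⟨h1, h2⟩
    · rw [openSegment_symm ℝ (p i)]
      have hk := hp.nonneg_in he' h1 (by omega : k ≤ j)
      have hl := hp.nonneg_in he' (by omega : i ≤ l) h2
      refine disjoint_openSegment hk hl ?_
      rcases (by omega : (i < k ∧ k < j) ∨ (i < l ∧ l < j)) with h | h
      · have := hp.pos_in he' h.1 h.2
        linarith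
      · have := hp.pos_in he' h.1 h.2
        linarith
    · have hk := hp.nonneg_out he he' (by omega : k < n) h1
      have hl := hp.nonneg_out he he' hf' h2
      refine disjoint_openSegment hk hl ?_
      rcases (by omega : (k < i ∨ j < k) ∨ (l < i ∨ j < l)) with h | h
      · have := hp.pos_out he he' (by omega : k < n) h
        linarith
      · have := hp.pos_out he he' hf' h
        linarith
  · rintro (h | h)
    · exact hp.crossing_of_lt h.1 h.2.1 h.2.2 hf'
    · exact crossing_comm.mp (hp.crossing_of_lt h.1 h.2.1 h.2.2 he')

theorem isVertexLabelling (hp : IsEnumeration V n p) (hn : 3 ≤ n) : IsVertexLabelling V n p :=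
  ⟨hp.mem, hp.surj, fun _ hi _ hj => hp.injOn hn hi hj,
    fun _ _ he he' hf hf' => hp.crossing_iff he he' hf hf'⟩

theorem disjoint_interior (hp : IsEnumeration V n p) {i j k : ℕ}
    (hnn : ∀ m < n, 0 ≤ orient (p i) (p j) (p m)) (hpos : 0 < orient (p i) (p j) (p k)) :
    Disjoint (hull s(p i, p j)) (interior (convexHull ℝ (V : Set Plane))) := by
  rw [hull_mk, Set.disjoint_left]
  rintro x ⟨α, β, -, -, hαβ, rfl⟩ hx
  have hV : ∀ y ∈ convexHull ℝ (V : Set Plane), 0 ≤ orient (p i) (p j) y := by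
    refine fun y hy => orient_nonneg_of_mem_convexHull (fun z hz => ?_) hy
    obtain ⟨m, hm, rfl⟩ := hp.surj z hz
    exact hnn m hm
  have := orient_pos_of_mem_interior hV hpos hx
  rw [orient_combo _ _ _ _ hαβ, orient_left_self, orient_right_self] at this
  simp at this

theorem not_disjoint_interior (hp : IsEnumeration V n p) {i k j l : ℕ} (hik : i < k) (hkj : k < j)
    (hl : l < n) (hj : j < n) (hlij : l < i ∨ j < l) :
    ¬ Disjoint (hull s(p i, p j)) (interior (convexHull ℝ (V : Set Plane))) := by
  have hij : i < j := by omega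
  have a1 : 0 < orient (p i) (p k) (p j) := hp.pos i k j hik hkj hj
  have a2 : 0 < orient (p i) (p j) (p l) := hp.pos_out hij hj hl hlij
  -- The open quadrilateral `i`, `k`, `j`, `l`, which contains the midpoint of its diagonal from `p
  -- i` to `p j`.
  set W : Set Plane := {z | (0 < orient (p i) (p k) z ∧ 0 < orient (p k) (p j) z) ∧
    (0 < orient (p j) (p l) z ∧ 0 < orient (p l) (p i) z)} with hW
  have hWo : IsOpen W := by
    have ho : ∀ a b : Plane, IsOpen {z | 0 < orient a b z} := fun a b =>
      isOpen_lt continuous_const (continuous_orient a b)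
    exact ((ho _ _).inter (ho _ _)).inter ((ho _ _).inter (ho _ _))
  have hWs : W ⊆ convexHull ℝ (V : Set Plane) := by
    rintro z ⟨⟨h1, h2⟩, h3, h4⟩
    rcases le_total 0 (orient (p i) (p j) z) with h | h
    · refine convexHull_mono ?_ (mem_convexHull_triangle a2 h h3.le h4.le)
      rintro y (rfl | rfl | rfl)
      exacts [hp.mem i (by omega), hp.mem j hj, hp.mem l hl]
    · refine convexHull_mono ?_ (mem_convexHull_triangle a1 h1.le h2.le
        (by rw [orient_swap]; linarith))
      rintro y (rfl | rfl | rfl)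
      exacts [hp.mem i (by omega), hp.mem k (by omega), hp.mem j hj]
  rw [hull_mk, Set.not_disjoint_iff]
  refine ⟨(1 / 2 : ℝ) • p i + (1 / 2 : ℝ) • p j,
    ⟨_, _, by norm_num, by norm_num, by norm_num, rfl⟩, interior_maximal hWs hWo ?_⟩
  rw [hW, Set.mem_ofPred_eq]
  have b1 : orient (p k) (p j) (p i) = orient (p i) (p k) (p j) := (orient_rotate _ _ _).symm
  have b2 : orient (p j) (p l) (p i) = orient (p i) (p j) (p l) := (orient_rotate _ _ _).symm
  have b3 : orient (p l) (p i) (p j) = orient (p i) (p j) (p l) := orient_rotate _ _ _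
  simp only [orient_combo _ _ _ _ (by norm_num : (1 / 2 : ℝ) + 1 / 2 = 1), orient_left_self,
    orient_right_self, b1, b2, b3]
  refine ⟨⟨?_, ?_⟩, ?_, ?_⟩ <;> linarith

theorem isEdgeOf_iff (hp : IsEnumeration V n p) (hn : 3 ≤ n) {i j : ℕ} (hij : i < j) (hj : j < n) :
    IsEdgeOf V s(p i, p j) ↔ j = i + 1 ∨ (i = 0 ∧ j = n - 1) := by
  constructor
  · rintro ⟨-, h⟩
    by_contra hne
    obtain ⟨l, hl, hlij⟩ : ∃ l < n, l < i ∨ j < l := by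
      by_cases h0 : 0 < i
      · exact ⟨0, by omega, Or.inl h0⟩
      · exact ⟨n - 1, by omega, by omega⟩
    exact hp.not_disjoint_interior (k := i + 1) (by omega) (by omega) hl hj hlij h
  · rintro (rfl | ⟨rfl, rfl⟩)
    · refine ⟨(hp.isVertexLabelling hn).isEdgeOn hij hj, ?_⟩
      obtain ⟨k, hk, hki⟩ : ∃ k < n, k < i ∨ i + 1 < k := by
        by_cases h0 : 0 < i
        · exact ⟨0, by omega, Or.inl h0⟩
        · exact ⟨n - 1, by omega, by omega⟩
      exact hp.disjoint_interior (k := k) (fun m hm => hp.nonneg_out hij hj hm (by omega))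
        (hp.pos_out hij hj hk hki)
    · refine ⟨(hp.isVertexLabelling hn).isEdgeOn hij hj, ?_⟩
      rw [Sym2.eq_swap]
      exact hp.disjoint_interior (k := 1)
        (fun m hm => hp.nonneg_in hj (by omega) (by omega)) (hp.pos_in hj (by omega) (by omega))

end IsEnumeration

/-! ### Triangulations as sets of index pairs -/

/-- The edges on a polygon with vertices `0, …, n - 1`, as increasing pairs. -/
def indexEdges (n : ℕ) : Finset (ℕ × ℕ) :=
  (Finset.range n ×ˢ Finset.range n).filter (fun e => e.1 < e.2)

theorem mem_indexEdges {n : ℕ} {e : ℕ × ℕ} : e ∈ indexEdges n ↔ e.1 < e.2 ∧ e.2 < n := by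
  simp only [indexEdges, Finset.mem_filter, Finset.mem_product, Finset.mem_range]
  omega

/-- A maximal set of pairwise non-interleaving pairs. -/
structure IsIndexTriangulation (n : ℕ) (S : Finset (ℕ × ℕ)) : Prop where
  subset : ∀ e ∈ S, e.1 < e.2 ∧ e.2 < n
  noncrossing : ∀ e ∈ S, ∀ f ∈ S, ¬ Interleave e f
  maximal : ∀ e : ℕ × ℕ, e.1 < e.2 → e.2 < n → (∀ f ∈ S, ¬ Interleave e f) → e ∈ S

theorem exists_isIndexTriangulation_superset {n : ℕ} {Z : Finset (ℕ × ℕ)}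
    (hZ : ∀ e ∈ Z, e.1 < e.2 ∧ e.2 < n) (hZZ : ∀ e ∈ Z, ∀ f ∈ Z, ¬ Interleave e f) :
    ∃ S, Z ⊆ S ∧ IsIndexTriangulation n S := by
  classical
  have hfin : {S : Finset (ℕ × ℕ) | S ⊆ indexEdges n ∧
      ∀ e ∈ S, ∀ f ∈ S, ¬ Interleave e f}.Finite :=
    (indexEdges n).powerset.finite_toSet.subset fun S hS => by simpa using hS.1
  obtain ⟨S, hZS, hS⟩ := hfin.exists_le_maximal
    (a := Z) ⟨fun e he => mem_indexEdges.mpr (hZ e he), hZZ⟩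
  refine ⟨S, hZS, fun e he => mem_indexEdges.mp (hS.prop.1 he), hS.prop.2, ?_⟩
  intro e he he' hef
  have hle : insert e S ≤ S := by
    refine hS.le_of_ge ⟨?_, ?_⟩ (Finset.subset_insert e S)
    · exact Finset.insert_subset (mem_indexEdges.mpr ⟨he, he'⟩) hS.prop.1
    · intro f hf g hg
      rw [Finset.mem_insert] at hf hg
      rcases hf with rfl | hf <;> rcases hg with rfl | hg
      · simp [Interleave]
      · exact hef g hg
      · exact fun h => hef f hf h.symm
      · exact hS.prop.2 f hf g hg
  exact hle (Finset.mem_insert_self e S)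

namespace IsIndexTriangulation

variable {n : ℕ} {S S' : Finset (ℕ × ℕ)}

theorem side_mem (hS : IsIndexTriangulation n S) {i : ℕ} (hi : i + 1 < n) : (i, i + 1) ∈ S := by
  refine hS.maximal _ (by simp) hi fun f _ hI => ?_
  simp only [Interleave] at hI
  omega

theorem last_side_mem (hS : IsIndexTriangulation n S) (hn : 2 ≤ n) : (0, n - 1) ∈ S := by
  refine hS.maximal _ (by simp; omega) (by simp; omega) fun f hf hI => ?_
  have := hS.subset f hf
  simp only [Interleave] at hI
  omega

/-- By maximality `e` crosses an edge of `S`, and all of these except `g` coexist with `e` in `S'`.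
-/
theorem interleave_of_flip (hS : IsIndexTriangulation n S) (hS' : IsIndexTriangulation n S')
    {e g : ℕ × ℕ} (he : e ∈ S') (heS : e ∉ S) (hd : ∀ f ∈ S, f ≠ g → f ∈ S') :
    Interleave e g := by
  by_contra hI
  refine heS (hS.maximal e (hS'.subset e he).1 (hS'.subset e he).2 fun f hf hef => ?_)
  by_cases hfg : f = g
  · exact hI (hfg ▸ hef)
  · exact hS'.noncrossing e he f (hd f hf hfg) hef

/-- An edge crossing a side of the quadrilateral `a b c d` is a diagonal or crosses a diagonal. The
edges of `S` other than `g` cross neither `e` nor `g`, so maximality puts the four sides in `S`. -/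
theorem quadrilateral (hS : IsIndexTriangulation n S) (hS' : IsIndexTriangulation n S')
    {e g : ℕ × ℕ} {a b c d : ℕ} (he : e ∈ S') (hg : g ∈ S) (hd : ∀ f ∈ S, f ≠ g → f ∈ S')
    (hab : a < b) (hbc : b < c) (hcd : c < d)
    (h : (e = (a, c) ∧ g = (b, d)) ∨ (e = (b, d) ∧ g = (a, c))) :
    (a, b) ∈ S ∧ (b, c) ∈ S ∧ (c, d) ∈ S ∧ (a, d) ∈ S := by
  have hdn : d < n := by
    have h1 := hS.subset g hg
    have h2 := hS'.subset e he
    rcases h with ⟨rfl, rfl⟩ | ⟨rfl, rfl⟩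
    · exact h1.2
    · exact h2.2
  have key : ∀ x y, x < y → y < n → ((x = a ∧ y = b) ∨ (x = b ∧ y = c) ∨ (x = c ∧ y = d) ∨
      (x = a ∧ y = d)) → (x, y) ∈ S := by
    intro x y hxy hyn hcase
    refine hS.maximal _ hxy hyn fun f hf hI => ?_
    have hfS := hS.subset f hf
    have h1 := hS.noncrossing f hf g hg
    by_cases hfg : f = g
    · subst hfg
      rcases h with ⟨rfl, rfl⟩ | ⟨rfl, rfl⟩ <;> simp only [Interleave] at hI <;> omega
    · have h2 := hS'.noncrossing f (hd f hf hfg) e he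
      obtain ⟨f1, f2⟩ := f
      rcases h with ⟨rfl, rfl⟩ | ⟨rfl, rfl⟩ <;> simp only [Interleave] at hI h1 h2 <;> omega
  exact ⟨key a b hab (by omega) (by omega), key b c hbc (by omega) (by omega),
    key c d hcd hdn (by omega), key a d (by omega) hdn (by omega)⟩

/-- If edges of the two triangulations crossed, a fan edge from `0` to an end of one would cross the
other. -/
theorem eq_of_full_fan (hS : IsIndexTriangulation n S) (hS' : IsIndexTriangulation n S')
    (h : ∀ j, 0 < j → j < n → (0, j) ∈ S) (h' : ∀ j, 0 < j → j < n → (0, j) ∈ S') : S = S' := by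
  have key : ∀ {S S'}, IsIndexTriangulation n S → IsIndexTriangulation n S' →
      (∀ j, 0 < j → j < n → (0, j) ∈ S) → (∀ j, 0 < j → j < n → (0, j) ∈ S') → S ⊆ S' := by
    intro S S' hS hS' h h' e he
    have he' := hS.subset e he
    refine hS'.maximal e he'.1 he'.2 fun f hf hI => ?_
    have hf' := hS'.subset f hf
    have h1 := hS'.noncrossing f hf (0, e.2) (h' _ (by omega) (by omega))
    have h2 := hS.noncrossing e he (0, f.2) (h _ (by omega) (by omega))
    have h3 := hS'.noncrossing f hf (0, e.1)
    have h4 := hS.noncrossing e he (0, f.1)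
    have h5 : 0 < e.1 → (0, e.1) ∈ S' := fun h0 => h' _ h0 (by omega)
    have h6 : 0 < f.1 → (0, f.1) ∈ S := fun h0 => h _ h0 (by omega)
    simp only [Interleave] at *
    rcases hI with hI | hI
    · exact h4 (h6 (by omega)) (by omega)
    · exact h3 (h5 (by omega)) (by omega)
  exact (key hS hS' h h').antisymm (key hS' hS h' h)

/-- A missing interior edge at the vertex `0` can be introduced by a flip, for some such edge,
without removing an edge at `0`. -/
theorem exists_flip (hS : IsIndexTriangulation n S) {m : ℕ} (hm : 0 < m) (hmn : m < n)
    (hmS : (0, m) ∉ S) : ∃ r g, 2 ≤ r ∧ r ≤ n - 2 ∧ (0, r) ∉ S ∧ g ∈ S ∧ 0 < g.1 ∧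
      IsIndexTriangulation n (insert (0, r) (S.erase g)) := by
  classical
  have hm1 : m ≠ 1 := by rintro rfl; exact hmS (hS.side_mem hmn)
  have hmn1 : m ≠ n - 1 := by rintro rfl; exact hmS (hS.last_side_mem (by omega))
  -- The neighbours `x < m < y` of `0` closest to `m` form a triangle of `S` with `0`.
  obtain ⟨x, hx, hxmax⟩ := ((Finset.range m).filter fun j => 0 < j ∧ (0, j) ∈ S).exists_maximal
    ⟨1, by simp only [Finset.mem_filter, Finset.mem_range]
           exact ⟨by omega, by omega, hS.side_mem (by omega)⟩⟩
  obtain ⟨y, hy, hymin⟩ := ((Finset.range n).filter fun j => m < j ∧ (0, j) ∈ S).exists_minimal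
    ⟨n - 1, by simp only [Finset.mem_filter, Finset.mem_range]
               exact ⟨by omega, by omega, hS.last_side_mem (by omega)⟩⟩
  simp only [Finset.mem_filter, Finset.mem_range] at hx hxmax hy hymin
  obtain ⟨hxm, hx0, hxS⟩ := hx
  obtain ⟨hyn, hmy, hyS⟩ := hy
  have hgap : ∀ j, x < j → j < y → (0, j) ∉ S := by
    intro j hxj hjy hj
    rcases lt_trichotomy j m with h | rfl | h
    · have := hxmax ⟨h, by omega, hj⟩ hxj.le; omega
    · exact hmS hj
    · have := hymin ⟨by omega, h, hj⟩ hjy.le; omega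
  have hxy : (x, y) ∈ S := by
    refine hS.maximal _ (by simp; omega) hyn fun f hf hI => ?_
    have h1 := hS.noncrossing f hf _ hxS
    have h2 := hS.noncrossing f hf _ hyS
    obtain ⟨f1, f2⟩ := f
    simp only [Interleave] at hI h1 h2
    have hf1 : f1 = 0 := by omega
    subst hf1
    exact hgap f2 (by omega) (by omega) hf
  -- The apex `r` of the triangle on the other side of `(x, y)`; the flip replaces `(x, y)` by `(0,
  -- r)`.
  obtain ⟨r, hr, hrmax⟩ := ((Finset.range y).filter fun j => x < j ∧ (x, j) ∈ S).exists_maximal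
    ⟨x + 1, by simp only [Finset.mem_filter, Finset.mem_range]
               exact ⟨by omega, by omega, hS.side_mem (by omega)⟩⟩
  simp only [Finset.mem_filter, Finset.mem_range] at hr hrmax
  obtain ⟨hry, hxr, hrS⟩ := hr
  have hryS : (r, y) ∈ S := by
    refine hS.maximal _ hry hyn fun f hf hI => ?_
    have h1 := hS.noncrossing f hf _ hrS
    have h2 := hS.noncrossing f hf _ hxy
    obtain ⟨f1, f2⟩ := f
    simp only [Interleave] at hI h1 h2
    have hf1 : f1 = x := by omega
    subst hf1
    have := hrmax ⟨by omega, by omega, hf⟩ (by omega)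
    omega
  refine ⟨r, (x, y), by omega, by omega, hgap r hxr hry, hxy, hx0, ?_, ?_, ?_⟩
  · intro e he
    rcases Finset.mem_insert.mp he with rfl | he
    · simp only; omega
    · exact hS.subset e (Finset.mem_of_mem_erase he)
  · have key : ∀ f ∈ S.erase (x, y), ¬ Interleave (0, r) f := by
      intro f hf hI
      have hfS := Finset.mem_of_mem_erase hf
      have hfne := Finset.ne_of_mem_erase hf
      have h1 := hS.noncrossing f hfS _ hxS
      have h2 := hS.noncrossing f hfS _ hyS
      have h3 := hS.noncrossing f hfS _ hrS
      have h4 := hS.noncrossing f hfS _ hryS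
      obtain ⟨f1, f2⟩ := f
      simp only [Interleave, ne_eq, Prod.mk.injEq] at *
      omega
    intro e he f hf
    rw [Finset.mem_insert] at he hf
    rcases he with rfl | he <;> rcases hf with rfl | hf
    · simp [Interleave]
    · exact key f hf
    · exact fun h => key e he h.symm
    · exact hS.noncrossing e (Finset.mem_of_mem_erase he) f (Finset.mem_of_mem_erase hf)
  · intro e he hen hcr
    have hmem : ∀ f ∈ S, f ≠ (x, y) → ¬ Interleave e f := fun f hf hne =>
      hcr f (Finset.mem_insert_of_mem (Finset.mem_erase.mpr ⟨hne, hf⟩))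
    by_cases hI : Interleave e (x, y)
    · apply Finset.mem_insert.mpr
      left
      have h1 := hmem _ hxS (by simp; omega)
      have h2 := hmem _ hyS (by simp; omega)
      have h3 := hmem _ hrS (by simp; omega)
      have h4 := hmem _ hryS (by simp; omega)
      obtain ⟨e1, e2⟩ := e
      simp only [Interleave, Prod.mk.injEq] at *
      omega
    · have heS : e ∈ S := hS.maximal e he hen fun f hf hef => by
        by_cases hfe : f = (x, y)
        · exact hI (hfe ▸ hef)
        · exact hmem f hf hfe hef
      refine Finset.mem_insert_of_mem (Finset.mem_erase.mpr ⟨?_, heS⟩)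
      rintro rfl
      refine hcr (0, r) (Finset.mem_insert_self _ _) ?_
      simp only [Interleave]
      omega

/-- This concerns the triangle on the side `(0, n - 1)`: without interior edges at `0`, the edge
`(1, n - 1)` cuts off the ear at `0`. -/
theorem exists_interior_at_ends (hS : IsIndexTriangulation n S) (hn : 4 ≤ n) :
    ∃ j, 1 ≤ j ∧ j ≤ n - 2 ∧ ((2 ≤ j ∧ (0, j) ∈ S) ∨ (j ≤ n - 3 ∧ (j, n - 1) ∈ S)) := by
  by_cases h : ∃ j, 2 ≤ j ∧ j ≤ n - 2 ∧ (0, j) ∈ S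
  · obtain ⟨j, h2, hj, hjS⟩ := h
    exact ⟨j, by omega, hj, Or.inl ⟨h2, hjS⟩⟩
  · push Not at h
    refine ⟨1, le_rfl, by omega, Or.inr ⟨by omega, ?_⟩⟩
    refine hS.maximal _ (by simp; omega) (by simp; omega) fun f hf hI => ?_
    have := hS.subset f hf
    obtain ⟨f1, f2⟩ := f
    simp only [Interleave] at hI this
    have hf1 : f1 = 0 := by omega
    subst hf1
    exact h f2 (by omega) (by omega) hf

end IsIndexTriangulation

/-! ### The double fan and the zigzag -/

/-- The triangulation whose interior edges are the edges from `0` to `2, …, D + 1`, the edges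
from `n - 1` to `D + 1, …, 2 * D` and, if `n = 2 * D + 4`, the edge between `n - 4` and `n - 2`. -/
def doubleFan (D n : ℕ) : Finset (ℕ × ℕ) :=
  (indexEdges n).filter fun e => e.2 = e.1 + 1 ∨ (e.1 = 0 ∧ e.2 = n - 1) ∨
    (e.1 = 0 ∧ e.2 ≤ D + 1) ∨ (e.2 = n - 1 ∧ D + 1 ≤ e.1 ∧ e.1 ≤ 2 * D) ∨
    (e.1 = 2 * D ∧ e.2 = n - 2)

theorem mem_doubleFan {D n i j : ℕ} : (i, j) ∈ doubleFan D n ↔ (i < j ∧ j < n) ∧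
    (j = i + 1 ∨ (i = 0 ∧ j = n - 1) ∨ (i = 0 ∧ j ≤ D + 1) ∨
      (j = n - 1 ∧ D + 1 ≤ i ∧ i ≤ 2 * D) ∨ (i = 2 * D ∧ j = n - 2)) := by
  rw [doubleFan, Finset.mem_filter, mem_indexEdges]

/-- A zigzag between the vertices `1, …, D` and the vertices `D + 2, …, n - 2`. -/
def zigzag (D n : ℕ) : Finset (ℕ × ℕ) :=
  (indexEdges n).filter fun e => 1 ≤ e.1 ∧ e.1 ≤ D ∧ D + 2 ≤ e.2 ∧ e.2 ≤ n - 2 ∧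
    (e.1 + e.2 = 2 * D + 2 ∨ e.1 + e.2 = 2 * D + 3)

theorem mem_zigzag {D n i j : ℕ} : (i, j) ∈ zigzag D n ↔ (i < j ∧ j < n) ∧
    1 ≤ i ∧ i ≤ D ∧ D + 2 ≤ j ∧ j ≤ n - 2 ∧ (i + j = 2 * D + 2 ∨ i + j = 2 * D + 3) := by
  rw [zigzag, Finset.mem_filter, mem_indexEdges]

section

variable {D n : ℕ}

theorem isIndexTriangulation_doubleFan (hD : 2 ≤ D) (hn : n = 2 * D + 3 ∨ n = 2 * D + 4) :
    IsIndexTriangulation n (doubleFan D n) := by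
  refine ⟨fun e he => (mem_doubleFan.mp he).1, ?_, ?_⟩
  · rintro ⟨i, j⟩ he ⟨k, l⟩ hf hI
    rw [mem_doubleFan] at he hf
    simp only [Interleave] at hI
    omega
  · rintro ⟨i, j⟩ hij hj h
    simp only at hij hj
    rw [mem_doubleFan]
    by_contra hne
    have h' : ∀ k l, (k, l) ∈ doubleFan D n → ¬ Interleave (i, j) (k, l) := fun k l => h (k, l)
    simp only [mem_doubleFan, Interleave] at h'
    rcases Nat.eq_zero_or_pos i with rfl | hi
    · have := h' (D + 1) (n - 1)
      omega
    rcases Nat.lt_or_ge j (n - 1) with hjn | hjn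
    · rcases Nat.lt_or_ge D i with hiD | hiD
      · have := h' (i + 1) (n - 1)
        omega
      · have := h' 0 (i + 1)
        omega
    · rcases Nat.lt_or_ge D i with hiD | hiD
      · have := h' (2 * D) (n - 2)
        omega
      · have := h' 0 (D + 1)
        omega

theorem zigzag_noncrossing : ∀ e ∈ zigzag D n, ∀ f ∈ zigzag D n, ¬ Interleave e f := by
  rintro ⟨i, j⟩ he ⟨k, l⟩ hf hI
  rw [mem_zigzag] at he hf
  simp only [Interleave] at hI
  omega

theorem not_mem_doubleFan_of_mem_zigzag {e : ℕ × ℕ} (he : e ∈ zigzag D n) : e ∉ doubleFan D n := by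
  obtain ⟨i, j⟩ := e
  rw [mem_zigzag] at he
  rw [mem_doubleFan]
  omega

theorem card_zigzag (hn : n = 2 * D + 3 ∨ n = 2 * D + 4) :
    n - 4 ≤ (zigzag D n).card := by
  classical
  set A := (Finset.Icc 1 D).image fun i => (i, 2 * D + 2 - i)
  -- The lower end is `2` or `1`: when `n = 2 * D + 3`, the partner of `1` would be the excluded
  -- vertex `n - 1`.
  set B := (Finset.Icc (2 * D + 5 - n) D).image fun i => (i, 2 * D + 3 - i)
  have hA : A.card = D := by
    rw [Finset.card_image_of_injective _ fun a b h => (Prod.mk.inj h).1]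
    simp
  have hB : B.card = n - 4 - D := by
    rw [Finset.card_image_of_injective _ fun a b h => (Prod.mk.inj h).1, Nat.card_Icc]
    omega
  have hAB : Disjoint A B := by
    rw [Finset.disjoint_left]
    rintro ⟨i, j⟩ h1 h2
    simp only [A, B, Finset.mem_image, Finset.mem_Icc, Prod.mk.injEq] at h1 h2
    obtain ⟨a, ha, rfl, rfl⟩ := h1
    obtain ⟨b, hb, rfl, h⟩ := h2
    omega
  calc n - 4 ≤ (A ∪ B).card := by rw [Finset.card_union_of_disjoint hAB, hA, hB]; omega
    _ ≤ (zigzag D n).card := Finset.card_le_card ?_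
  rintro ⟨i, j⟩ h
  rw [mem_zigzag]
  simp only [A, B, Finset.mem_union, Finset.mem_image, Finset.mem_Icc, Prod.mk.injEq] at h
  rcases h with ⟨a, ha, rfl, rfl⟩ | ⟨a, ha, rfl, rfl⟩ <;> omega

/-! ### Counting wasted flips -/

/-- The edges `e` and `f` share a vertex. -/
def Touch (e f : ℕ × ℕ) : Prop := e.1 = f.1 ∨ e.1 = f.2 ∨ e.2 = f.1 ∨ e.2 = f.2

instance (e f : ℕ × ℕ) : Decidable (Touch e f) := by unfold Touch; infer_instance

theorem card_zigzag_incident (v : ℕ) :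
    ((zigzag D n).filter fun e => e.1 = v ∨ e.2 = v).card ≤ 2 := by
  classical
  by_cases hv : v ≤ D
  · refine (Finset.card_le_card (t := {(v, 2 * D + 2 - v), (v, 2 * D + 3 - v)}) ?_).trans
      Finset.card_le_two
    rintro ⟨i, j⟩ h
    rw [Finset.mem_filter, mem_zigzag] at h
    simp only [Finset.mem_insert, Finset.mem_singleton, Prod.mk.injEq] at h ⊢
    omega
  · refine (Finset.card_le_card (t := {(2 * D + 2 - v, v), (2 * D + 3 - v, v)}) ?_).trans
      Finset.card_le_two
    rintro ⟨i, j⟩ h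
    rw [Finset.mem_filter, mem_zigzag] at h
    simp only [Finset.mem_insert, Finset.mem_singleton, Prod.mk.injEq] at h ⊢
    omega

theorem card_zigzag_touch (N : Finset (ℕ × ℕ)) :
    ((zigzag D n).filter fun e => ∃ g ∈ N, Touch e g).card ≤ 4 * N.card := by
  classical
  have hsub : ((zigzag D n).filter fun e => ∃ g ∈ N, Touch e g) ⊆
      N.biUnion fun g => ((zigzag D n).filter fun e => e.1 = g.1 ∨ e.2 = g.1) ∪
        ((zigzag D n).filter fun e => e.1 = g.2 ∨ e.2 = g.2) := by
    intro e he
    obtain ⟨heZ, g, hg, h⟩ := Finset.mem_filter.mp he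
    refine Finset.mem_biUnion.mpr ⟨g, hg, ?_⟩
    simp only [Finset.mem_union, Finset.mem_filter, heZ, true_and]
    simp only [Touch] at h
    omega
  refine (Finset.card_le_card hsub).trans ?_
  rw [mul_comm]
  refine Finset.card_biUnion_le_card_mul _ _ _ fun g _ => ?_
  refine (Finset.card_union_le _ _).trans ?_
  have h1 := card_zigzag_incident (D := D) (n := n) g.1
  have h2 := card_zigzag_incident (D := D) (n := n) g.2
  omega

/-- A flip replacing an edge of the double fan by an edge of the zigzag takes place in a
quadrilateral with a side in neither of them. -/
theorem exists_side_of_flip (hD : 2 ≤ D)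
    {S S' : Finset (ℕ × ℕ)} (hS : IsIndexTriangulation n S) (hS' : IsIndexTriangulation n S')
    {e g : ℕ × ℕ} (he : e ∈ S') (heS : e ∉ S) (hg : g ∈ S) (hd : ∀ f ∈ S, f ≠ g → f ∈ S')
    (heZ : e ∈ zigzag D n) (hgT : g ∈ doubleFan D n) :
    ∃ s ∈ S, s ∉ doubleFan D n ∧ s ∉ zigzag D n ∧ Touch e s := by
  have hI := hS.interleave_of_flip hS' he heS hd
  obtain ⟨i, j⟩ := e
  obtain ⟨k, l⟩ := g
  have heZ' := mem_zigzag.mp heZ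
  have hgT' := mem_doubleFan.mp hgT
  by_contra hcon
  push Not at hcon
  have hcon' : ∀ x y, (x, y) ∈ S → (x, y) ∉ doubleFan D n → (x, y) ∉ zigzag D n →
    ¬ Touch (i, j) (x, y) := fun x y => hcon (x, y)
  simp only [mem_doubleFan, mem_zigzag, Touch] at hcon'
  simp only [Interleave] at hI
  -- If `g` is at `n - 1`, the side `(i, n - 1)` is bad; if `g` is at `0`, the side `(0, j)` is. For
  -- `n = 2 * D + 4` the extra edge `(2 * D, n - 2)` forces `j = 2 * D + 1` and `i ≤ 2`, and the bad
  -- side is `(1, 2 * D)` or `(2, n - 2)`.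
  rcases hI with hI | hI
  · obtain ⟨h1, h2, h3, h4⟩ := hS.quadrilateral hS' he hg hd hI.1 hI.2.1 hI.2.2
      (Or.inl ⟨rfl, rfl⟩)
    have c1 := hcon' _ _ h1
    have c4 := hcon' _ _ h4
    omega
  · obtain ⟨h1, h2, h3, h4⟩ := hS.quadrilateral hS' he hg hd hI.1 hI.2.1 hI.2.2
      (Or.inr ⟨rfl, rfl⟩)
    have c4 := hcon' _ _ h4
    have c3 := hcon' _ _ h3
    omega

theorem card_filter_insert_erase {α : Type*} [DecidableEq α] {S : Finset α} {e g : α}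
    (he : e ∉ S) (hg : g ∈ S) (P : α → Prop) [DecidablePred P] :
    ((insert e (S.erase g)).filter P).card + (if P g then 1 else 0) =
      (S.filter P).card + (if P e then 1 else 0) := by
  have h1 : ∀ s : Finset α, (s.filter P).card = ∑ x ∈ s, if P x then 1 else 0 := fun s =>
    Finset.card_filter _ _
  have heg : e ∉ S.erase g := fun h => he (Finset.mem_of_mem_erase h)
  rw [h1, h1, Finset.sum_insert heg, ← Finset.sum_erase_add S _ hg]
  ring

/-- An invariant of the triangulations reached from the double fan by `m` flips: `ν` of these
flips have been wasted, and the edges in `N` have been introduced in the process. -/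
def Reachable (D n : ℕ) (S : Finset (ℕ × ℕ)) (m : ℕ) : Prop :=
  ∃ (N : Finset (ℕ × ℕ)) (ν : ℕ), N.card ≤ ν ∧
    (∀ e ∈ S, e ∉ doubleFan D n → e ∉ zigzag D n → e ∈ N) ∧
    ν + (S.filter fun e => e ∈ zigzag D n).card ≤ m ∧
    (S.filter fun e => e ∈ zigzag D n ∧ ¬ ∃ g ∈ N, Touch e g).card +
      (S.filter fun e => e ∉ doubleFan D n ∧ e ∉ zigzag D n).card ≤ ν

theorem reachable_doubleFan : Reachable D n (doubleFan D n) 0 := by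
  refine ⟨∅, 0, le_rfl, fun e he he' => (he' he).elim, ?_, ?_⟩
  · rw [zero_add, Nat.le_zero, Finset.card_eq_zero, Finset.filter_eq_empty_iff]
    exact fun e he heZ => not_mem_doubleFan_of_mem_zigzag heZ he
  · rw [Nat.le_zero, Nat.add_eq_zero_iff, Finset.card_eq_zero, Finset.card_eq_zero,
      Finset.filter_eq_empty_iff, Finset.filter_eq_empty_iff]
    exact ⟨fun e he heZ => not_mem_doubleFan_of_mem_zigzag heZ.1 he, fun e he h => h.1 he⟩

/-- A zigzag edge that touches no edge of `N` when introduced cannot replace a double fan edge. It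
replaces a zigzag edge, a newly wasted flip, or a bad edge still present, whose wasted flip is
already counted in `ν`. This keeps the last inequality of the invariant. -/
theorem Reachable.flip (hD : 2 ≤ D)
    {S : Finset (ℕ × ℕ)} {m : ℕ} (h : Reachable D n S m) (hS : IsIndexTriangulation n S)
    {e g : ℕ × ℕ} (he : e ∉ S) (hg : g ∈ S)
    (hS' : IsIndexTriangulation n (insert e (S.erase g))) :
    Reachable D n (insert e (S.erase g)) (m + 1) := by
  classical
  obtain ⟨N, ν, hN, hbad, hm, hν⟩ := h
  have c1 := card_filter_insert_erase he hg fun x => x ∈ zigzag D n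
  have c2 := card_filter_insert_erase he hg fun x => x ∈ zigzag D n ∧ ¬ ∃ y ∈ N, Touch x y
  have c3 := card_filter_insert_erase he hg fun x => x ∉ doubleFan D n ∧ x ∉ zigzag D n
  have hbad' : (e ∈ doubleFan D n ∨ e ∈ zigzag D n) →
      ∀ x ∈ insert e (S.erase g), x ∉ doubleFan D n → x ∉ zigzag D n → x ∈ N := by
    intro h x hx hxT hxZ
    rcases Finset.mem_insert.mp hx with rfl | hx
    · exact (h.elim hxT hxZ).elim
    · exact hbad x (Finset.mem_of_mem_erase hx) hxT hxZ
  by_cases heZ : e ∈ zigzag D n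
  · have heT := not_mem_doubleFan_of_mem_zigzag heZ
    by_cases hgZ : g ∈ zigzag D n
    · refine ⟨N, ν + 1, by omega, hbad' (Or.inr heZ), ?_, ?_⟩
      · simp only [heZ, hgZ, if_true] at c1
        omega
      · rw [if_neg (fun h => h.2 hgZ), if_neg (fun h => h.2 heZ)] at c3
        split_ifs at c2 <;> omega
    · refine ⟨N, ν, hN, hbad' (Or.inr heZ), ?_, ?_⟩
      · simp only [heZ, hgZ, if_true, if_false] at c1
        omega
      · by_cases hgT : g ∈ doubleFan D n
        -- The bad side is in `N`, so `e` does not count as untouched.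
        · obtain ⟨s, hsS, hsT, hsZ, hs⟩ := exists_side_of_flip hD hS hS'
            (Finset.mem_insert_self _ _) he hg
            (fun f hf hfg => Finset.mem_insert_of_mem (Finset.mem_erase.mpr ⟨hfg, hf⟩)) heZ hgT
          have htouch : ∃ y ∈ N, Touch e y := ⟨s, hbad s hsS hsT hsZ, hs⟩
          rw [if_neg (fun h => hgZ h.1), if_neg (fun h => h.2 htouch)] at c2
          rw [if_neg (fun h => h.1 hgT), if_neg (fun h => h.2 heZ)] at c3
          omega
        -- The bad edge `g` disappears and makes room for `e` in the count.
        · rw [if_neg (fun h => hgZ h.1)] at c2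
          rw [if_pos ⟨hgT, hgZ⟩, if_neg (fun h => h.2 heZ)] at c3
          split_ifs at c2 <;> omega
  · by_cases heT : e ∈ doubleFan D n
    · refine ⟨N, ν, hN, hbad' (Or.inl heT), ?_, ?_⟩
      · rw [if_neg heZ] at c1
        omega
      · rw [if_neg (c := e ∈ zigzag D n ∧ _) (fun h => heZ h.1)] at c2
        rw [if_neg (c := e ∉ doubleFan D n ∧ _) (fun h => h.1 heT)] at c3
        omega
    · refine ⟨insert e N, ν + 1, (Finset.card_insert_le _ _).trans (by omega), ?_, ?_, ?_⟩
      · intro x hx hxT hxZ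
        rcases Finset.mem_insert.mp hx with rfl | hx
        · exact Finset.mem_insert_self _ _
        · exact Finset.mem_insert_of_mem (hbad x (Finset.mem_of_mem_erase hx) hxT hxZ)
      · rw [if_neg heZ] at c1
        omega
      · rw [if_neg (c := e ∈ zigzag D n ∧ _) (fun h => heZ h.1)] at c2
        rw [if_pos (c := e ∉ doubleFan D n ∧ _) ⟨heT, heZ⟩] at c3
        have hle : ((insert e (S.erase g)).filter fun x =>
            x ∈ zigzag D n ∧ ¬ ∃ y ∈ insert e N, Touch x y).card ≤
            ((insert e (S.erase g)).filter fun x =>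
              x ∈ zigzag D n ∧ ¬ ∃ y ∈ N, Touch x y).card := by
          refine Finset.card_le_card fun x hx => ?_
          rw [Finset.mem_filter] at hx ⊢
          refine ⟨hx.1, hx.2.1, fun ⟨y, hy, hxy⟩ => hx.2.2 ⟨y, Finset.mem_insert_of_mem hy, hxy⟩⟩
        omega

/-- Reaching a triangulation that contains the zigzag wastes at least `(n - 4) / 5` flips. -/
theorem Reachable.le_of_zigzag_subset (hn : n = 2 * D + 3 ∨ n = 2 * D + 4)
    {S : Finset (ℕ × ℕ)} {m : ℕ} (h : Reachable D n S m) (hZ : zigzag D n ⊆ S) :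
    6 * (n - 4) ≤ 5 * m := by
  classical
  obtain ⟨N, ν, hN, -, hm, hν⟩ := h
  have h0 := card_zigzag hn
  have h1 := card_zigzag_touch (D := D) (n := n) N
  have h2 : (zigzag D n).card ≤ (S.filter fun e => e ∈ zigzag D n).card :=
    Finset.card_le_card fun e he => Finset.mem_filter.mpr ⟨hZ he, he⟩
  have h3 : ((zigzag D n).filter fun e => ¬ ∃ g ∈ N, Touch e g).card ≤
      (S.filter fun e => e ∈ zigzag D n ∧ ¬ ∃ g ∈ N, Touch e g).card := by
    refine Finset.card_le_card fun e he => ?_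
    rw [Finset.mem_filter] at he ⊢
    exact ⟨hZ he.1, he⟩
  have h4 := Finset.card_filter_add_card_filter_not (s := zigzag D n)
    (fun e => ∃ g ∈ N, Touch e g)
  -- At most `4 * ν` zigzag edges are touched and at most `ν` are not, so the zigzag has at most `5
  -- * ν` edges, while `m` is at least `ν` plus their number.
  omega

end

/-! ### Passing between triangulations and index sets -/

open Classical in
/-- The pairs of indices of the edges in `T`. -/
noncomputable def indexSet (p : ℕ → Plane) (n : ℕ) (T : Set (Sym2 Plane)) : Finset (ℕ × ℕ) :=
  (indexEdges n).filter fun e => s(p e.1, p e.2) ∈ T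

theorem mem_indexSet {p : ℕ → Plane} {n i j : ℕ} {T : Set (Sym2 Plane)} :
    (i, j) ∈ indexSet p n T ↔ (i < j ∧ j < n) ∧ s(p i, p j) ∈ T := by
  classical
  rw [indexSet, Finset.mem_filter, mem_indexEdges]

open Classical in
/-- The number of interior edges of `T` incident to the vertex `p 0`. -/
noncomputable def fanDegree (p : ℕ → Plane) (n : ℕ) (T : Set (Sym2 Plane)) : ℕ :=
  ((Finset.Icc 2 (n - 2)).filter fun j => s(p 0, p j) ∈ T).card

theorem fanDegree_le (p : ℕ → Plane) (n : ℕ) (T : Set (Sym2 Plane)) :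
    fanDegree p n T ≤ n - 3 := by
  classical
  refine (Finset.card_filter_le _ _).trans ?_
  rw [Nat.card_Icc]
  omega

theorem card_le_fanDegree {p : ℕ → Plane} {n : ℕ} {T : Set (Sym2 Plane)} {J : Finset ℕ}
    (hJ : ∀ j ∈ J, 2 ≤ j ∧ j ≤ n - 2 ∧ s(p 0, p j) ∈ T) : J.card ≤ fanDegree p n T := by
  classical
  refine Finset.card_le_card fun j hj => ?_
  obtain ⟨h1, h2, h3⟩ := hJ j hj
  exact Finset.mem_filter.mpr ⟨Finset.mem_Icc.mpr ⟨h1, h2⟩, h3⟩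

namespace IsVertexLabelling

variable {V : Finset Plane} {n : ℕ} {p : ℕ → Plane}

theorem mk_eq_mk (hp : IsVertexLabelling V n p) {i j k l : ℕ} (hij : i < j) (hj : j < n)
    (hkl : k < l) (hl : l < n) (h : s(p i, p j) = s(p k, p l)) : i = k ∧ j = l := by
  rcases Sym2.eq_iff.mp h with ⟨h1, h2⟩ | ⟨h1, h2⟩
  · exact ⟨hp.inj _ (by omega) _ (by omega) h1, hp.inj _ hj _ hl h2⟩
  · have := hp.inj _ (by omega) _ hl h1
    have := hp.inj _ hj _ (by omega) h2
    omega

theorem isIndexTriangulation_indexSet (hp : IsVertexLabelling V n p) {T : Set (Sym2 Plane)}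
    (hT : IsTriangulation V T) : IsIndexTriangulation n (indexSet p n T) := by
  refine ⟨fun e he => (mem_indexSet.mp he).1, ?_, ?_⟩
  · rintro ⟨i, j⟩ he ⟨k, l⟩ hf hI
    rw [mem_indexSet] at he hf
    have hne : (i, j) ≠ (k, l) := by
      intro h
      rw [Prod.mk.injEq] at h
      simp only [Interleave] at hI
      omega
    refine hT.prop.2 he.2 hf.2 (fun h => hne ?_)
      ((hp.crossing (i, j) (k, l) he.1.1 he.1.2 hf.1.1 hf.1.2 hne).mpr hI)
    have := hp.mk_eq_mk he.1.1 he.1.2 hf.1.1 hf.1.2 h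
    rw [this.1, this.2]
  · rintro ⟨i, j⟩ hij hj hcr
    simp only at hij hj
    refine mem_indexSet.mpr ⟨⟨hij, hj⟩, ?_⟩
    by_contra hnot
    have key : ∀ f ∈ T, ¬ Crossing s(p i, p j) f := by
      intro f hf hfc
      obtain ⟨k, l, hkl, hl, rfl⟩ := hp.exists_of_isEdgeOn (hT.prop.1 f hf)
      have hne : (i, j) ≠ (k, l) := by
        intro h
        rw [Prod.mk.injEq] at h
        obtain ⟨rfl, rfl⟩ := h
        exact hnot hf
      exact hcr (k, l) (mem_indexSet.mpr ⟨⟨hkl, hl⟩, hf⟩)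
        ((hp.crossing (i, j) (k, l) hij hj hkl hl hne).mp hfc)
    have hle : insert s(p i, p j) T ≤ T := by
      refine hT.le_of_ge ⟨?_, ?_⟩ (Set.subset_insert _ _)
      · rintro e (rfl | he)
        · exact hp.isEdgeOn hij hj
        · exact hT.prop.1 e he
      · refine hT.prop.2.insert fun f hf _ => ⟨key f hf, ?_⟩
        rw [crossing_comm]
        exact key f hf
    exact hnot (hle (Set.mem_insert _ _))

theorem exists_triangulation (hp : IsVertexLabelling V n p) {S : Finset (ℕ × ℕ)}
    (hS : IsIndexTriangulation n S) : ∃ T : Triangulation V, indexSet p n T.1 = S := by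
  set T : Set (Sym2 Plane) := (fun e : ℕ × ℕ => s(p e.1, p e.2)) '' S with hTdef
  have hmem : ∀ i j, i < j → j < n → s(p i, p j) ∈ T → (i, j) ∈ S := by
    rintro i j hij hj ⟨⟨k, l⟩, hkl, h⟩
    have h2 := hS.subset _ hkl
    obtain ⟨rfl, rfl⟩ := hp.mk_eq_mk h2.1 h2.2 hij hj h
    exact hkl
  have hT : IsTriangulation V T := by
    refine ⟨⟨?_, ?_⟩, ?_⟩
    · rintro _ ⟨e, he, rfl⟩
      exact hp.isEdgeOn (hS.subset e he).1 (hS.subset e he).2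
    · rintro _ ⟨e, he, rfl⟩ _ ⟨f, hf, rfl⟩ hef hc
      have hne : e ≠ f := fun h => hef (by rw [h])
      exact hS.noncrossing e he f hf ((hp.crossing e f (hS.subset e he).1 (hS.subset e he).2
        (hS.subset f hf).1 (hS.subset f hf).2 hne).mp hc)
    · rintro U ⟨hU1, hU2⟩ hTU e heU
      obtain ⟨i, j, hij, hj, rfl⟩ := hp.exists_of_isEdgeOn (hU1 e heU)
      refine ⟨(i, j), hS.maximal (i, j) hij hj fun f hf hI => ?_, rfl⟩
      have hf' := hS.subset f hf
      have hne : (i, j) ≠ f := by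
        rintro rfl
        simp [Interleave] at hI
      refine hU2 heU (hTU ⟨f, hf, rfl⟩) (fun h => hne ?_)
        ((hp.crossing (i, j) f hij hj hf'.1 hf'.2 hne).mpr hI)
      have := hp.mk_eq_mk hij hj hf'.1 hf'.2 h
      exact Prod.ext this.1 this.2
  refine ⟨⟨T, hT⟩, ?_⟩
  ext ⟨i, j⟩
  rw [mem_indexSet]
  constructor
  · rintro ⟨⟨h1, h2⟩, h3⟩
    exact hmem i j h1 h2 h3
  · intro h
    exact ⟨hS.subset _ h, (i, j), h, rfl⟩

theorem eq_of_indexSet_eq (hp : IsVertexLabelling V n p) {T U : Triangulation V}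
    (h : indexSet p n T.1 = indexSet p n U.1) : T = U := by
  have key : ∀ {T U : Triangulation V}, indexSet p n T.1 = indexSet p n U.1 → T.1 ⊆ U.1 := by
    intro T U h e he
    obtain ⟨i, j, hij, hj, rfl⟩ := hp.exists_of_isEdgeOn (T.2.prop.1 e he)
    have : (i, j) ∈ indexSet p n T.1 := mem_indexSet.mpr ⟨⟨hij, hj⟩, he⟩
    rw [h] at this
    exact (mem_indexSet.mp this).2
  exact Subtype.ext ((key h).antisymm (key h.symm))

theorem adj_of_indexSet (hp : IsVertexLabelling V n p) {T U : Triangulation V} {e g : ℕ × ℕ}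
    (he : e ∉ indexSet p n T.1) (hg : g ∈ indexSet p n T.1)
    (h : indexSet p n U.1 = insert e ((indexSet p n T.1).erase g)) : (flipGraph V).Adj T U := by
  have heU : e ∈ indexSet p n U.1 := h ▸ Finset.mem_insert_self _ _
  have heg : e ≠ g := fun heg => he (heg ▸ hg)
  have hgU : g ∉ indexSet p n U.1 := by
    rw [h, Finset.mem_insert]
    rintro (hge | hge)
    · exact heg hge.symm
    · exact Finset.ne_of_mem_erase hge rfl
  have he' := mem_indexSet.mp heU
  have hg' := mem_indexSet.mp hg
  refine ⟨s(p g.1, p g.2), s(p e.1, p e.2), ?_, ?_⟩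
  · ext x
    rw [Set.mem_singleton_iff]
    constructor
    · rintro ⟨hxT, hxU⟩
      obtain ⟨i, j, hij, hj, rfl⟩ := hp.exists_of_isEdgeOn (T.2.prop.1 x hxT)
      by_contra hne
      refine hxU (mem_indexSet.mp (?_ : (i, j) ∈ indexSet p n U.1)).2
      rw [h]
      refine Finset.mem_insert_of_mem (Finset.mem_erase.mpr ⟨?_, mem_indexSet.mpr ⟨⟨hij, hj⟩, hxT⟩⟩)
      rintro rfl
      exact hne rfl
    · rintro rfl
      exact ⟨hg'.2, fun hU => hgU (mem_indexSet.mpr ⟨hg'.1, hU⟩)⟩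
  · ext x
    rw [Set.mem_singleton_iff]
    constructor
    · rintro ⟨hxU, hxT⟩
      obtain ⟨i, j, hij, hj, rfl⟩ := hp.exists_of_isEdgeOn (U.2.prop.1 x hxU)
      have : (i, j) ∈ indexSet p n U.1 := mem_indexSet.mpr ⟨⟨hij, hj⟩, hxU⟩
      rw [h] at this
      rcases Finset.mem_insert.mp this with rfl | h3
      · rfl
      · exact (hxT (mem_indexSet.mp (Finset.mem_of_mem_erase h3)).2).elim
    · rintro rfl
      exact ⟨he'.2, fun hT => he (mem_indexSet.mpr ⟨he'.1, hT⟩)⟩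

theorem exists_of_adj (hp : IsVertexLabelling V n p) {T U : Triangulation V}
    (h : (flipGraph V).Adj T U) : ∃ e g, e ∉ indexSet p n T.1 ∧ g ∈ indexSet p n T.1 ∧
      indexSet p n U.1 = insert e ((indexSet p n T.1).erase g) := by
  obtain ⟨x, y, hx, hy⟩ := h
  have hxm : x ∈ T.1 \ U.1 := hx ▸ Set.mem_singleton x
  have hym : y ∈ U.1 \ T.1 := hy ▸ Set.mem_singleton y
  obtain ⟨k, l, hkl, hl, rfl⟩ := hp.exists_of_isEdgeOn (T.2.prop.1 x hxm.1)
  obtain ⟨i, j, hij, hj, rfl⟩ := hp.exists_of_isEdgeOn (U.2.prop.1 y hym.1)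
  refine ⟨(i, j), (k, l), fun h => hym.2 (mem_indexSet.mp h).2,
    mem_indexSet.mpr ⟨⟨hkl, hl⟩, hxm.1⟩, ?_⟩
  ext ⟨a, b⟩
  rw [Finset.mem_insert, Finset.mem_erase, mem_indexSet, mem_indexSet]
  constructor
  · rintro ⟨hab, hU⟩
    by_cases hT : s(p a, p b) ∈ T.1
    · right
      refine ⟨fun h => ?_, hab, hT⟩
      rw [Prod.mk.injEq] at h
      rw [h.1, h.2] at hU
      exact hxm.2 hU
    · left
      have : s(p a, p b) ∈ U.1 \ T.1 := ⟨hU, hT⟩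
      rw [hy] at this
      obtain ⟨rfl, rfl⟩ := hp.mk_eq_mk hab.1 hab.2 hij hj this
      rfl
  · rintro (h | ⟨hne, hab, hT⟩)
    · rw [Prod.mk.injEq] at h
      rw [h.1, h.2]
      exact ⟨⟨hij, hj⟩, hym.1⟩
    · refine ⟨hab, ?_⟩
      by_contra hU
      have : s(p a, p b) ∈ T.1 \ U.1 := ⟨hT, hU⟩
      rw [hx] at this
      obtain ⟨rfl, rfl⟩ := hp.mk_eq_mk hab.1 hab.2 hkl hl this
      exact hne rfl

/-! ### Distances through a fan -/

/-- While the fan at `0` is incomplete, `exists_flip` gains one of its `n - 3` interior edges per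
flip and loses none. -/
theorem exists_fan_edist_le (hp : IsVertexLabelling V n p) (T : Triangulation V) :
    ∃ U : Triangulation V, (∀ j, 0 < j → j < n → (0, j) ∈ indexSet p n U.1) ∧
      (flipGraph V).edist T U ≤ (n - 3 - fanDegree p n T.1 : ℕ) := by
  classical
  induction hm : n - 3 - fanDegree p n T.1 using Nat.strong_induction_on generalizing T with
  | _ m ih =>
    by_cases hfull : ∀ j, 0 < j → j < n → (0, j) ∈ indexSet p n T.1
    · exact ⟨T, hfull, by rw [SimpleGraph.edist_self]; exact zero_le⟩
    · push Not at hfull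
      obtain ⟨j, hj0, hjn, hj⟩ := hfull
      obtain ⟨r, g, hr2, hrn, hr, hg, hg0, hU⟩ :=
        (hp.isIndexTriangulation_indexSet T.2).exists_flip hj0 hjn hj
      obtain ⟨U, hUS⟩ := hp.exists_triangulation hU
      have hdeg : fanDegree p n T.1 + 1 ≤ fanDegree p n U.1 := by
        have hrT : s(p 0, p r) ∉ T.1 := fun h => hr (mem_indexSet.mpr ⟨by omega, h⟩)
        rw [fanDegree, ← Finset.card_insert_of_notMem (a := r) (by simp [hrT])]
        refine card_le_fanDegree fun i hi => ?_
        rcases Finset.mem_insert.mp hi with rfl | hi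
        · refine ⟨hr2, hrn, (mem_indexSet.mp (?_ : (0, i) ∈ indexSet p n U.1)).2⟩
          rw [hUS]
          exact Finset.mem_insert_self _ _
        · rw [Finset.mem_filter, Finset.mem_Icc] at hi
          refine ⟨hi.1.1, hi.1.2, (mem_indexSet.mp (?_ : (0, i) ∈ indexSet p n U.1)).2⟩
          rw [hUS]
          refine Finset.mem_insert_of_mem (Finset.mem_erase.mpr ⟨?_, mem_indexSet.mpr
            ⟨by omega, hi.2⟩⟩)
          rintro rfl
          exact hg0.ne rfl
      have hUle := fanDegree_le p n U.1
      obtain ⟨W, hW, hWd⟩ := ih (n - 3 - fanDegree p n U.1) (by omega) U rfl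
      refine ⟨W, hW, ?_⟩
      calc (flipGraph V).edist T W
          ≤ (flipGraph V).edist T U + (flipGraph V).edist U W := SimpleGraph.edist_triangle
        _ ≤ 1 + (n - 3 - fanDegree p n U.1 : ℕ) := by
            gcongr
            exact (SimpleGraph.edist_eq_one_iff_adj.mpr (hp.adj_of_indexSet hr hg hUS)).le
        _ ≤ m := by
            norm_cast
            omega

theorem edist_le (hp : IsVertexLabelling V n p) (T U : Triangulation V) :
    (flipGraph V).edist T U ≤
      (n - 3 - fanDegree p n T.1 + (n - 3 - fanDegree p n U.1) : ℕ) := by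
  obtain ⟨T', hT', hTd⟩ := hp.exists_fan_edist_le T
  obtain ⟨U', hU', hUd⟩ := hp.exists_fan_edist_le U
  have h : T' = U' := hp.eq_of_indexSet_eq
    ((hp.isIndexTriangulation_indexSet T'.2).eq_of_full_fan
      (hp.isIndexTriangulation_indexSet U'.2) hT' hU')
  subst h
  rw [SimpleGraph.edist_comm] at hUd
  calc (flipGraph V).edist T U
      ≤ (flipGraph V).edist T T' + (flipGraph V).edist T' U := SimpleGraph.edist_triangle
    _ ≤ _ := by
      push_cast
      exact add_le_add hTd hUd

/-! ### Distances from the double fan -/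

variable {D : ℕ}

theorem reachable_of_walk (hp : IsVertexLabelling V n p) (hD : 2 ≤ D) {T U : Triangulation V}
    (w : (flipGraph V).Walk T U) {m : ℕ} (hT : Reachable D n (indexSet p n T.1) m) :
    Reachable D n (indexSet p n U.1) (m + w.length) := by
  induction w generalizing m with
  | nil => exact hT
  | @cons T T' U hadj w ih =>
    obtain ⟨e, g, he, hg, h⟩ := hp.exists_of_adj hadj
    have h' := hT.flip hD (hp.isIndexTriangulation_indexSet T.2) he hg
      (h ▸ hp.isIndexTriangulation_indexSet T'.2)
    rw [← h] at h'
    have := ih h'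
    rwa [SimpleGraph.Walk.length_cons, add_comm w.length, ← add_assoc]

theorem exists_le_edist (hp : IsVertexLabelling V n p) (hD : 2 ≤ D)
    (hn : n = 2 * D + 3 ∨ n = 2 * D + 4) {T : Triangulation V}
    (hT : indexSet p n T.1 = doubleFan D n) :
    ∃ U : Triangulation V, ∀ w : (flipGraph V).Walk T U, 6 * (n - 4) ≤ 5 * w.length := by
  obtain ⟨S, hZS, hS⟩ := exists_isIndexTriangulation_superset
    (fun e he => (mem_zigzag (D := D) (n := n).mp he).1) zigzag_noncrossing
  obtain ⟨U, hU⟩ := hp.exists_triangulation hS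
  refine ⟨U, fun w => ?_⟩
  have h := hp.reachable_of_walk hD w (m := 0) (hT ▸ reachable_doubleFan)
  rw [zero_add, hU] at h
  exact h.le_of_zigzag_subset hn hZS

/-- The double fan has `D` interior edges at both `0` and `n - 1`, so the fan can be taken at
whichever of the two carries an interior edge of `U`; the other one is handled by the reversed
labelling. -/
theorem edist_doubleFan_le (hp : IsVertexLabelling V n p) (hD : 2 ≤ D)
    (hn : n = 2 * D + 3 ∨ n = 2 * D + 4) {T : Triangulation V}
    (hT : indexSet p n T.1 = doubleFan D n) (U : Triangulation V) :
    (flipGraph V).edist T U ≤ (2 * n - 7 - D : ℕ) := by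
  have hTmem : ∀ i j, (i, j) ∈ doubleFan D n → s(p i, p j) ∈ T.1 := fun i j h =>
    (mem_indexSet.mp (hT ▸ h : (i, j) ∈ indexSet p n T.1)).2
  have h1 : D ≤ fanDegree p n T.1 := by
    have := card_le_fanDegree (p := p) (n := n) (T := T.1) (J := Finset.Icc 2 (D + 1)) ?_
    · simpa using this
    · intro j hj
      rw [Finset.mem_Icc] at hj
      exact ⟨hj.1, by omega, hTmem 0 j (mem_doubleFan.mpr (by omega))⟩
  have h2 : D ≤ fanDegree (fun i => p (n - 1 - i)) n T.1 := by
    -- The neighbours `D + 1, …, 2 * D` of `n - 1`, in reversed labels.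
    have := card_le_fanDegree (p := fun i => p (n - 1 - i)) (n := n) (T := T.1)
      (J := Finset.Icc (n - 1 - 2 * D) (n - 2 - D)) ?_
    · rw [Nat.card_Icc] at this
      omega
    · intro j hj
      rw [Finset.mem_Icc] at hj
      refine ⟨by omega, by omega, ?_⟩
      rw [Sym2.eq_swap]
      exact hTmem _ _ (mem_doubleFan.mpr (by omega))
  have h3 : 1 ≤ fanDegree p n U.1 ∨ 1 ≤ fanDegree (fun i => p (n - 1 - i)) n U.1 := by
    obtain ⟨j, hj1, hj, ⟨hj2, hjU⟩ | ⟨hj3, hjU⟩⟩ :=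
      (hp.isIndexTriangulation_indexSet U.2).exists_interior_at_ends (by omega)
    · left
      rw [← Finset.card_singleton j]
      refine card_le_fanDegree fun i hi => ?_
      rw [Finset.mem_singleton.mp hi]
      exact ⟨hj2, hj, (mem_indexSet.mp hjU).2⟩
    · right
      refine (Finset.card_singleton (n - 1 - j)).ge.trans (card_le_fanDegree fun i hi => ?_)
      rw [Finset.mem_singleton.mp hi, Sym2.eq_swap,
        show n - 1 - (n - 1 - j) = j by omega]
      exact ⟨by omega, by omega, (mem_indexSet.mp hjU).2⟩
  rcases h3 with h3 | h3
  · refine (hp.edist_le T U).trans ?_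
    norm_cast
    omega
  · refine (hp.reverse.edist_le T U).trans ?_
    norm_cast
    omega

end IsVertexLabelling

/-! ### Degrees of the double fan and conclusion -/

theorem IsEnumeration.interiorDegree_doubleFan_le {V : Finset Plane} {n D : ℕ} {p : ℕ → Plane}
    (hp : IsEnumeration V n p) (hD : 2 ≤ D) (hn : n = 2 * D + 3 ∨ n = 2 * D + 4)
    {T : Triangulation V} (hT : indexSet p n T.1 = doubleFan D n) {v : Plane} (hv : v ∈ V) :
    interiorDegree T v ≤ D := by
  classical
  obtain ⟨i, hi, rfl⟩ := hp.surj v hv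
  have hpl := hp.isVertexLabelling (by omega)
  -- `J` is to contain the other ends of the interior edges at `i`. Apart from `0` and `n - 1`, two
  -- ends suffice, which is where `2 ≤ D` is used.
  have key : ∀ J : Finset ℕ, J.card ≤ D →
      (∀ k l, (k, l) ∈ doubleFan D n → l ≠ k + 1 → ¬ (k = 0 ∧ l = n - 1) →
        (i = k → l ∈ J) ∧ (i = l → k ∈ J)) → interiorDegree T (p i) ≤ D := by
    intro J hJ h
    have hsub : {e | e ∈ interiorEdges T ∧ p i ∈ e} ⊆
        ((J.image fun j => s(p i, p j) : Finset (Sym2 Plane)) : Set (Sym2 Plane)) := by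
      rintro e ⟨⟨heT, heV⟩, hie⟩
      obtain ⟨k, l, hkl, hl, rfl⟩ := hpl.exists_of_isEdgeOn (T.2.prop.1 e heT)
      rw [hp.isEdgeOf_iff (by omega) hkl hl, not_or] at heV
      obtain ⟨h1, h2⟩ := h k l (hT ▸ mem_indexSet.mpr ⟨⟨hkl, hl⟩, heT⟩) heV.1 heV.2
      rw [Finset.coe_image]
      rcases Sym2.mem_iff.mp hie with hk | hk
      · have := hpl.inj _ hi _ (by omega) hk
        exact ⟨l, h1 this, by simp only [hk]⟩
      · have := hpl.inj _ hi _ hl hk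
        exact ⟨k, h2 this, by simp only [hk]; exact Sym2.eq_swap⟩
    calc interiorDegree T (p i) ≤ _ := Set.ncard_le_ncard hsub (Finset.finite_toSet _)
      _ = _ := Set.ncard_coe_finset _
      _ ≤ J.card := Finset.card_image_le
      _ ≤ D := hJ
  simp only [mem_doubleFan] at key
  by_cases h0 : i = 0
  · exact key (Finset.Icc 2 (D + 1)) (by simp) (by simp only [Finset.mem_Icc]; omega)
  by_cases h1 : i = n - 1
  · exact key (Finset.Icc (D + 1) (2 * D)) (by rw [Nat.card_Icc]; omega)
      (by simp only [Finset.mem_Icc]; omega)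
  by_cases h2 : i = 2 * D
  · exact key {n - 1, n - 2} (Finset.card_le_two.trans hD)
      (by simp only [Finset.mem_insert, Finset.mem_singleton]; omega)
  by_cases h3 : i = n - 2
  · exact key {2 * D} (by rw [Finset.card_singleton]; omega)
      (by simp only [Finset.mem_singleton]; omega)
  · exact key {0, n - 1} (Finset.card_le_two.trans hD)
      (by simp only [Finset.mem_insert, Finset.mem_singleton]; omega)

/-- A triangulation whose eccentricity `d` is less than `2 * (n - 3)` minus the largest number of
its interior edges incident to a vertex. -/
theorem exists_eccent_eq {V : Finset Plane} (hV : IsConvexPolygon V) {D n : ℕ}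
    (hcard : V.card = n) (hD : 2 ≤ D) (hn : n = 2 * D + 3 ∨ n = 2 * D + 4) :
    ∃ (T : Triangulation V) (d : ℕ), (flipGraph V).eccent T = d ∧ d ≤ 2 * n - 7 - D ∧
      6 * (n - 4) ≤ 5 * d ∧ ∀ v ∈ V, interiorDegree T v ≤ D := by
  obtain ⟨p, hp⟩ := exists_isEnumeration hV hcard
  have hpl := hp.isVertexLabelling (by omega)
  obtain ⟨T, hT⟩ := hpl.exists_triangulation (isIndexTriangulation_doubleFan hD hn)
  have hle : (flipGraph V).eccent T ≤ (2 * n - 7 - D : ℕ) :=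
    (SimpleGraph.eccent_le_iff _ _).mpr (hpl.edist_doubleFan_le hD hn hT)
  obtain ⟨d, hd⟩ := ENat.ne_top_iff_exists.mp (ne_top_of_le_ne_top (ENat.natCast_ne_top _) hle)
  refine ⟨T, d, hd.symm, ?_, ?_, fun v hv => hp.interiorDegree_doubleFan_le hD hn hT hv⟩
  · rw [← hd] at hle
    exact_mod_cast hle
  · obtain ⟨U, hU⟩ := hpl.exists_le_edist hD hn hT
    have hTU : (flipGraph V).edist T U ≤ d := hd ▸ SimpleGraph.edist_le_eccent
    obtain ⟨w, hw⟩ := (SimpleGraph.reachable_of_edist_ne_top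
      (ne_top_of_le_ne_top (ENat.natCast_ne_top d) hTU)).exists_walk_length_eq_edist
    rw [← hw] at hTU
    have hwd : w.length ≤ d := by exact_mod_cast hTU
    have := hU w
    omega

end FlipGraph

theorem mainTheorem7 (n : ℕ) (hn : 7 ≤ n) (V : Finset Plane)
    (hV : FlipGraph.IsConvexPolygon V) (hcard : V.card = n) :
    (∃ k : ℤ, (n : ℝ) / 8 - 5 / 2 < k ∧ (k : ℝ) ≤ n / 2 - 2 ∧
      ∃ T : FlipGraph.Triangulation V,
        (∀ v ∈ V, (FlipGraph.interiorDegree T v : ℤ) ≤ n - 4 - k) ∧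
        FlipGraph.HasEccentricity T (n - 3 + k)) ∧
    ¬ (∀ k : ℤ, 0 ≤ k → k ≤ ⌊(n : ℝ) / 2⌋ - 2 → ∀ T : FlipGraph.Triangulation V,
      (FlipGraph.HasEccentricity T (n - 3 + k) ↔
        ∃ v ∈ V, (FlipGraph.interiorDegree T v : ℤ) = n - 3 - k)) := by
  obtain ⟨D, hD⟩ : ∃ D, n = 2 * D + 3 ∨ n = 2 * D + 4 := ⟨(n - 3) / 2, by omega⟩
  obtain ⟨T, d, hd, hdle, hled, hdeg⟩ :=
    FlipGraph.exists_eccent_eq hV hcard (by omega : 2 ≤ D) hD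
  -- The lower bound on `d` becomes `5 * k ≥ n - 9`, giving `0 ≤ k` for `n ≥ 7` and the bound with
  -- `n / 8`; the upper one becomes `k ≤ n - 4 - D`, giving the degree bound and `k ≤ n / 2 - 2`.
  set k : ℤ := d - (n - 3) with hk
  have hecc : FlipGraph.HasEccentricity T (n - 3 + k) := ⟨d, hd, by rw [hk]; ring⟩
  have hdeg' : ∀ v ∈ V, (FlipGraph.interiorDegree T v : ℤ) ≤ n - 4 - k := by
    intro v hv
    have := hdeg v hv
    omega
  have hk0 : 0 ≤ k := by omega
  have hlow : (n : ℝ) / 8 - 5 / 2 < k := by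
    have : (n : ℤ) < 8 * k + 20 := by omega
    have : (n : ℝ) < 8 * k + 20 := by exact_mod_cast this
    linarith
  have hup : (k : ℝ) ≤ n / 2 - 2 := by
    have : 2 * k + 4 ≤ (n : ℤ) := by omega
    have : 2 * (k : ℝ) + 4 ≤ n := by exact_mod_cast this
    linarith
  refine ⟨⟨k, hlow, hup, T, hdeg', hecc⟩, fun h => ?_⟩
  have hfl : k ≤ ⌊(n : ℝ) / 2⌋ - 2 := by
    have : k + 2 ≤ ⌊(n : ℝ) / 2⌋ := by
      rw [Int.le_floor]
      push_cast
      linarith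
    linarith
  obtain ⟨v, hv, hv'⟩ := (h k hk0 hfl T).mp hecc
  have := hdeg' v hv
  omega
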